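/- **Setting.** Let $\mathbb{T}\subset\mathbb{R}$ be a time scale (nonempty closed set) with forward jump $\sigma$ and graininess $\mu$, and let $t_0\in\mathbb{T}^*\subseteq\mathbb{T}$. Let $\delta_\pm$ be forward and backward shift operators on $\mathbb{T}^*$ associated with $t_0$, with domains $\mathcal{D}_\pm=\{(s,t)\in[t_0,\infty)_{\mathbb{T}}\times\mathbb{T}^*:\delta_\pm(s,t)\in\mathbb{T}^*\}$; that is: 1. if $(s,t),(s,u)\in\mathcal{D}_\pm$ and $s\le t<u$, then $\delta_\pm(s,t)<\delta_\pm(s,u)$; 2. for $s_1<s_2$, $\delta_-(s_1,u)>\delta_-(s_2,u)$ if $(s_1,u),(s_2,u)\in\mathcal{D}_-$, and $\delta_+(s_1,u)<\delta_+(s_2,u)$ if $(s_1,u),(s_2,u)\in\mathcal{D}_+$; 3. $(t,t_0)\in\mathcal{D}_+$ and $\delta_+(t,t_0)=t$ for $t\in[t_0,\infty)_{\mathbb{T}}$; $(t_0,t)\in\mathcal{D}_+$ and $\delta_+(t_0,t)=t$ for $t\in\mathbb{T}^*$; 4. if $(s,t)\in\mathcal{D}_\pm$, then $(s,\delta_\pm(s,t))\in\mathcal{D}_\mp$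 and $\delta_\mp(s,\delta_\pm(s,t))=t$; 5. if $(s,t)\in\mathcal{D}_\pm$ and $(u,\delta_\pm(s,t))\in\mathcal{D}_\mp$, then $(s,\delta_\mp(u,t))\in\mathcal{D}_\pm$ and $\delta_\mp(u,\delta_\pm(s,t))=\delta_\pm(s,\delta_\mp(u,t))$. Assume that every $\mathbb{T}$-interval with end points $t_0$ and $t\in\mathbb{T}^*$ lies in $\mathbb{T}^*$. Let $\mathbb{T}$ be $T$-periodic in shifts: $T\in\mathbb{T}^*$, $T>t_0$, and $(T,t)\in\mathcal{D}_+\cap\mathcal{D}_-$ for all $t\in\mathbb{T}^*$. Write $\delta_\pm^T(t)=\delta_\pm(T,t)$ and assume that $\delta_\pm^T$ are $\Delta$-differentiable on $\mathbb{T}^*$ with rd-continuous derivatives $\delta_\pm^{\Delta T}$. Let $P_T$ be the set of continuous $x:\mathbb{T}^*\to\mathbb{R}^n$ with $x(\delta_\pm^T(t))=x(t)$ for all $t\in\mathbb{T}^*$. Fix $s\in[t_0,\infty)_{\mathbb{T}}$ with $(s,t)\in\mathcal{D}_-$ for all $t\in\mathbb{T}^*$. Let $A:\mathbb{T}^*\to\mathbb{R}^{n\times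 n}$ be rd-continuous and regressive ($I+\mu(t)A(t)$ is invertible for all $t\in\mathbb{T}^*$), and let $Q:\mathbb{T}^*\times\mathbb{R}^n\to\mathbb{R}^n$ and $G:\mathbb{T}^*\times\mathbb{R}^n\times\mathbb{R}^n\to\mathbb{R}^n$ be rd-continuous, in the sense that $t\mapsto Q(t,y(t))$ and $t\mapsto G(t,y(t),z(t))$ are rd-continuous for all continuous $y,z:\mathbb{T}^*\to\mathbb{R}^n$. Assume, for all $t\in\mathbb{T}^*$ and $y\in P_T$, $$A(\delta_\pm^T(t))\,\delta_\pm^{\Delta T}(t)=A(t),\qquad Q\big(\delta_\pm^T(t),y(\delta_-(s,\delta_\pm^T(t)))\big)=Q\big(t,y(\delta_-(s,t))\big),$$ $$G\big(\delta_\pm^T(t),y(\delta_\pm^T(t)),y(\delta_-(s,\delta_\pm^T(t)))\big)\,\delta_\pm^{\Delta T}(t)=G\big(t,y(t),y(\delta_-(s,t))\big),$$ and that for some $t\in\mathbb{T}^*$ the function $Q(\cdot,0)$ is $\Delta$-differentiable at $t$ with $Q^\Delta(t,0)+G(t,0,0)\neq0$. Assume finally that $z^\Delta=A(t)z$ is non-critical: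 it has no nonzero solution in $P_T$. Let $\Phi_A(t,t_0)$ be the transition matrix of $z^\Delta=A(t)z$: for $t\ge r$, $\Phi_A(t,r)$ is the Peano–Baker series $I+\int_r^tA(\tau_1)\Delta\tau_1+\int_r^tA(\tau_1)\int_r^{\tau_1}A(\tau_2)\Delta\tau_2\Delta\tau_1+\cdots$, and $\Phi_A(t,r)=\Phi_A(r,t)^{-1}$ for $t<r$. **Statement.** Let $x\in P_T$ and $x_0\in\mathbb{R}^n$. The matrices $\Phi_A(t,t_0)$ ($t\in\mathbb{T}^*$) and $\Phi_A^{-1}(\delta_+^T(t_0),t_0)-I$ are invertible. Consider $$x^\Delta(t)=A(t)x(t)+Q^\Delta\big(t,x(\delta_-(s,t))\big)+G\big(t,x(t),x(\delta_-(s,t))\big),\qquad t\in\mathbb{T}^*,\tag{1}$$ where $Q^\Delta(t,x(\delta_-(s,t)))$ is the $\Delta$-derivative of $t\mapsto Q(t,x(\delta_-(s,t)))$, and, for all $t\in\mathbb{T}^*$, $$x(t)=Q\big(t,x(\delta_-(s,t))\big)+\Phi_A(t,t_0)\big(\Phi_A^{-1}(\delta_+^T(t_0),t_0)-I\big)^{-1}\int_t^{\delta_+^T(t)}\Phi_A^{-1}(\sigma(u),t_0)\Big[A(u)Q\big(u,x(\delta_-(s,u))\big)+G\big(u,x(u),x(\delta_-(s,u))\big)\Big]\Delta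 u.\tag{2}$$ (a) If $t\mapsto Q(t,x(\delta_-(s,t)))$ is $\Delta$-differentiable on $\mathbb{T}^*$ (so that (1) is meaningful), then $x$ is a ($\Delta$-differentiable) solution of (1) with $x(t_0)=x_0$ if and only if $x$ satisfies (2) and $x(t_0)=x_0$. (b) Without that assumption, $x$ solves (1) in the neutral form $\big[x(t)-Q(t,x(\delta_-(s,t)))\big]^\Delta=A(t)x(t)+G(t,x(t),x(\delta_-(s,t)))$, $t\in\mathbb{T}^*$, with $x(t_0)=x_0$ if and only if $x$ satisfies (2) and $x(t_0)=x_0$. -/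

import Mathlib

open Set Filter Topology Matrix

noncomputable section

/-! ## Calculus on a time scale `𝕋` (a nonempty closed subset of the reals)

Functions on (a subset of) the time scale are represented by functions on `ℝ`, of which only the
values at the relevant points of the time scale matter. -/

open Classical in
/-- The forward jump operator `σ(t) = inf {r ∈ 𝕋 : r > t}`, with `σ(max 𝕋) = max 𝕋`. -/
def forwardJump (𝕋 : Set ℝ) (t : ℝ) : ℝ :=
  if (𝕋 ∩ Ioi t).Nonempty then sInf (𝕋 ∩ Ioi t) else t

/-- The graininess `μ(t) = σ(t) - t`. -/
def graininess (𝕋 : Set ℝ) (t : ℝ) : ℝ := forwardJump 𝕋 t - t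

/-- `f` has the delta derivative `f'` at the point `t` of the time scale `𝕋`. -/
def HasDeltaDeriv {E : Type*} [NormedAddCommGroup E] [NormedSpace ℝ E]
    (𝕋 : Set ℝ) (f : ℝ → E) (f' : E) (t : ℝ) : Prop :=
  ∀ ε > 0, ∃ η > 0, ∀ r ∈ 𝕋, |r - t| < η →
    ‖f (forwardJump 𝕋 t) - f r - (forwardJump 𝕋 t - r) • f'‖ ≤ ε * |forwardJump 𝕋 t - r|

/-- `f` is delta differentiable at every point of `S`. -/
def DeltaDifferentiableOn {E : Type*} [NormedAddCommGroup E] [NormedSpace ℝ E]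
    (𝕋 S : Set ℝ) (f : ℝ → E) : Prop :=
  ∀ t ∈ S, ∃ f' : E, HasDeltaDeriv 𝕋 f f' t

/-- The delta derivative `f^Δ(t)` (an arbitrary value where `f` is not delta differentiable). -/
def deltaDeriv {E : Type*} [NormedAddCommGroup E] [NormedSpace ℝ E]
    (𝕋 : Set ℝ) (f : ℝ → E) (t : ℝ) : E :=
  Classical.epsilon fun f' : E => HasDeltaDeriv 𝕋 f f' t

/-- `f` is rd-continuous at the points of `S`: continuous at right-dense points, and with a finite
left limit at left-dense points (where `t` is not left-dense, the filter `𝓝[𝕋 ∩ Iio t] t` is trivial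
and the second condition is void). -/
def RdContinuousOn {E : Type*} [TopologicalSpace E] (𝕋 S : Set ℝ) (f : ℝ → E) : Prop :=
  ∀ t ∈ S, (forwardJump 𝕋 t = t → ContinuousWithinAt f 𝕋 t) ∧
    ∃ l : E, Tendsto f (𝓝[𝕋 ∩ Iio t] t) (𝓝 l)

/-- The (Lebesgue) delta integral `∫_a^b f(u) Δu` for `a, b ∈ 𝕋`. The function `f` is extended to the
gaps of the time scale by its value at the left end of the gap, so that a right-scattered point `t`
contributes `μ(t) f(t)`, and the part of `[a, b]` in `𝕋` contributes the usual integral. -/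
def deltaIntegral {E : Type*} [NormedAddCommGroup E] [NormedSpace ℝ E]
    (𝕋 : Set ℝ) (f : ℝ → E) (a b : ℝ) : E :=
  ∫ u in a..b, f (sSup (𝕋 ∩ Iic u))

/-! ## Linear systems -/

/-- The terms of the Peano-Baker series with initial point `r`: the term of index `0` is `I`, and the
term of index `k + 1` is `∫_r^t A(τ) (k-th term)(τ) Δτ`, entry by entry. -/
def peanoBakerTerm {n : ℕ} (𝕋 : Set ℝ) (A : ℝ → Matrix (Fin n) (Fin n) ℝ) (r : ℝ) :
    ℕ → ℝ → Matrix (Fin n) (Fin n) ℝ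
  | 0 => fun _ => 1
  | k + 1 => fun t => Matrix.of fun i j =>
      deltaIntegral 𝕋 (fun τ => (A τ * peanoBakerTerm 𝕋 A r k τ) i j) r t

/-- The transition matrix `Φ_A(t, r)` of `z^Δ = A(t) z`: the Peano-Baker series for `t ≥ r`, and
`Φ_A(t, r) = Φ_A(r, t)⁻¹` for `t < r`, where the series need not converge. -/
def transitionMatrix {n : ℕ} (𝕋 : Set ℝ) (A : ℝ → Matrix (Fin n) (Fin n) ℝ) (t r : ℝ) :
    Matrix (Fin n) (Fin n) ℝ :=
  if r ≤ t then ∑' k, peanoBakerTerm 𝕋 A r k t else (∑' k, peanoBakerTerm 𝕋 A t k r)⁻¹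

/-- Regressivity: `I + μ(t) A(t)` is invertible for all `t ∈ S`. -/
def IsRegressiveOn {n : ℕ} (𝕋 S : Set ℝ) (A : ℝ → Matrix (Fin n) (Fin n) ℝ) : Prop :=
  ∀ t ∈ S, IsUnit (1 + graininess 𝕋 t • A t)

/-! ## Shift operators and periodicity -/

/-- The domain `{(s, t) ∈ [t₀, ∞)_𝕋 × 𝕋* : δ(s, t) ∈ 𝕋*}` of a shift operator. -/
def shiftDomain (𝕋 Tstar : Set ℝ) (t₀ : ℝ) (δ : ℝ → ℝ → ℝ) : Set (ℝ × ℝ) :=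
  {q | q.1 ∈ 𝕋 ∧ t₀ ≤ q.1 ∧ q.2 ∈ Tstar ∧ δ q.1 q.2 ∈ Tstar}

/-- `δp` and `δm` are the forward and backward shift operators `δ₊`, `δ₋` associated with the initial
point `t₀` on `𝕋*`. -/
structure IsShiftPair (𝕋 Tstar : Set ℝ) (t₀ : ℝ) (δp δm : ℝ → ℝ → ℝ) : Prop where
  subset : Tstar ⊆ 𝕋
  initial_mem : t₀ ∈ Tstar
  strictMono_p : ∀ s t u, (s, t) ∈ shiftDomain 𝕋 Tstar t₀ δp → (s, u) ∈ shiftDomain 𝕋 Tstar t₀ δp →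
    s ≤ t → t < u → δp s t < δp s u
  strictMono_m : ∀ s t u, (s, t) ∈ shiftDomain 𝕋 Tstar t₀ δm → (s, u) ∈ shiftDomain 𝕋 Tstar t₀ δm →
    s ≤ t → t < u → δm s t < δm s u
  first_m : ∀ s₁ s₂ u, (s₁, u) ∈ shiftDomain 𝕋 Tstar t₀ δm → (s₂, u) ∈ shiftDomain 𝕋 Tstar t₀ δm →
    s₁ < s₂ → δm s₂ u < δm s₁ u
  first_p : ∀ s₁ s₂ u, (s₁, u) ∈ shiftDomain 𝕋 Tstar t₀ δp → (s₂, u) ∈ shiftDomain 𝕋 Tstar t₀ δp →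
    s₁ < s₂ → δp s₁ u < δp s₂ u
  apply_initial : ∀ t ∈ 𝕋, t₀ ≤ t → (t, t₀) ∈ shiftDomain 𝕋 Tstar t₀ δp ∧ δp t t₀ = t
  initial_apply : ∀ t ∈ Tstar, (t₀, t) ∈ shiftDomain 𝕋 Tstar t₀ δp ∧ δp t₀ t = t
  inv_p : ∀ s t, (s, t) ∈ shiftDomain 𝕋 Tstar t₀ δp →
    (s, δp s t) ∈ shiftDomain 𝕋 Tstar t₀ δm ∧ δm s (δp s t) = t
  inv_m : ∀ s t, (s, t) ∈ shiftDomain 𝕋 Tstar t₀ δm →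
    (s, δm s t) ∈ shiftDomain 𝕋 Tstar t₀ δp ∧ δp s (δm s t) = t
  comm_p : ∀ s t u, (s, t) ∈ shiftDomain 𝕋 Tstar t₀ δp →
    (u, δp s t) ∈ shiftDomain 𝕋 Tstar t₀ δm →
    (s, δm u t) ∈ shiftDomain 𝕋 Tstar t₀ δp ∧ δm u (δp s t) = δp s (δm u t)
  comm_m : ∀ s t u, (s, t) ∈ shiftDomain 𝕋 Tstar t₀ δm →
    (u, δm s t) ∈ shiftDomain 𝕋 Tstar t₀ δp →
    (s, δp u t) ∈ shiftDomain 𝕋 Tstar t₀ δm ∧ δp u (δm s t) = δm s (δp u t)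

/-- The time scale is `T`-periodic in shifts: `T ∈ (t₀, ∞) ∩ 𝕋*`, and `(T, t)` lies in the domains of
both shift operators for all `t ∈ 𝕋*`. -/
def IsPeriodicInShifts (𝕋 Tstar : Set ℝ) (t₀ : ℝ) (δp δm : ℝ → ℝ → ℝ) (T : ℝ) : Prop :=
  T ∈ Tstar ∧ t₀ < T ∧
    ∀ t ∈ Tstar, (T, t) ∈ shiftDomain 𝕋 Tstar t₀ δp ∧ (T, t) ∈ shiftDomain 𝕋 Tstar t₀ δm

/-- The shifts `δ₊^T`, `δ₋^T` are delta differentiable on `𝕋*` with rd-continuous derivatives. -/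
def SmoothShifts (𝕋 Tstar : Set ℝ) (δp δm : ℝ → ℝ → ℝ) (T : ℝ) : Prop :=
  DeltaDifferentiableOn 𝕋 Tstar (δp T) ∧ RdContinuousOn 𝕋 Tstar (deltaDeriv 𝕋 (δp T)) ∧
  DeltaDifferentiableOn 𝕋 Tstar (δm T) ∧ RdContinuousOn 𝕋 Tstar (deltaDeriv 𝕋 (δm T))

/-- The space `P_T` of continuous `n`-vector functions on `𝕋*` that are `T`-periodic in shifts. -/
def periodicSpace (n : ℕ) (Tstar : Set ℝ) (δp δm : ℝ → ℝ → ℝ) (T : ℝ) : Set (ℝ → Fin n → ℝ) :=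
  {x | ContinuousOn x Tstar ∧ ∀ t ∈ Tstar, x (δp T t) = x t ∧ x (δm T t) = x t}

/-- `f(δ_±^T(t)) (δ_±^T)^Δ(t) = f(t)` for all `t ∈ 𝕋*`. -/
def DeltaPeriodic {E : Type*} [SMul ℝ E] (𝕋 Tstar : Set ℝ) (δp δm : ℝ → ℝ → ℝ) (T : ℝ)
    (f : ℝ → E) : Prop :=
  ∀ t ∈ Tstar, deltaDeriv 𝕋 (δp T) t • f (δp T t) = f t ∧
    deltaDeriv 𝕋 (δm T) t • f (δm T t) = f t

/-- The system `z^Δ = A(t) z` is non-critical: it has no nonzero solution on `𝕋*` that is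
`T`-periodic in shifts. -/
def IsNoncritical {n : ℕ} (𝕋 Tstar : Set ℝ) (δp δm : ℝ → ℝ → ℝ) (T : ℝ)
    (A : ℝ → Matrix (Fin n) (Fin n) ℝ) : Prop :=
  ¬ ∃ z ∈ periodicSpace n Tstar δp δm T,
    (∀ t ∈ Tstar, HasDeltaDeriv 𝕋 z (A t *ᵥ z t) t) ∧ ∃ t ∈ Tstar, z t ≠ 0

/-! ## The neutral system -/

/-- `x` is delta differentiable and solves
`x^Δ(t) = A(t) x(t) + Q^Δ(t, x(δ₋(s,t))) + G(t, x(t), x(δ₋(s,t)))` on `𝕋*`, where `Q^Δ(t, x(δ₋(s,t)))`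
is the delta derivative of the function `t ↦ Q(t, x(δ₋(s,t)))`, required to exist. -/
def IsSolution {n : ℕ} (𝕋 Tstar : Set ℝ) (δm : ℝ → ℝ → ℝ) (s : ℝ)
    (A : ℝ → Matrix (Fin n) (Fin n) ℝ) (Q : ℝ → (Fin n → ℝ) → (Fin n → ℝ))
    (G : ℝ → (Fin n → ℝ) → (Fin n → ℝ) → (Fin n → ℝ)) (x : ℝ → Fin n → ℝ) : Prop :=
  DeltaDifferentiableOn 𝕋 Tstar (fun r => Q r (x (δm s r))) ∧
  ∀ t ∈ Tstar, HasDeltaDeriv 𝕋 x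
    (A t *ᵥ x t + deltaDeriv 𝕋 (fun r => Q r (x (δm s r))) t + G t (x t) (x (δm s t))) t

/-- `x` solves the neutral system in the form
`[x(t) - Q(t, x(δ₋(s,t)))]^Δ = A(t) x(t) + G(t, x(t), x(δ₋(s,t)))` on `𝕋*`, in which only the
difference `x(t) - Q(t, x(δ₋(s,t)))` has to be delta differentiable. -/
def IsNeutralSolution {n : ℕ} (𝕋 Tstar : Set ℝ) (δm : ℝ → ℝ → ℝ) (s : ℝ)
    (A : ℝ → Matrix (Fin n) (Fin n) ℝ) (Q : ℝ → (Fin n → ℝ) → (Fin n → ℝ))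
    (G : ℝ → (Fin n → ℝ) → (Fin n → ℝ) → (Fin n → ℝ)) (x : ℝ → Fin n → ℝ) : Prop :=
  ∀ t ∈ Tstar, HasDeltaDeriv 𝕋 (fun r => x r - Q r (x (δm s r)))
    (A t *ᵥ x t + G t (x t) (x (δm s t))) t

/-- The integral equation, for all `t ∈ 𝕋*`. -/
def SatisfiesIntegralEquation {n : ℕ} (𝕋 Tstar : Set ℝ) (t₀ : ℝ) (δp δm : ℝ → ℝ → ℝ) (T s : ℝ)
    (A : ℝ → Matrix (Fin n) (Fin n) ℝ) (Q : ℝ → (Fin n → ℝ) → (Fin n → ℝ))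
    (G : ℝ → (Fin n → ℝ) → (Fin n → ℝ) → (Fin n → ℝ)) (x : ℝ → Fin n → ℝ) : Prop :=
  ∀ t ∈ Tstar, x t = Q t (x (δm s t)) +
    (transitionMatrix 𝕋 A t t₀ * ((transitionMatrix 𝕋 A (δp T t₀) t₀)⁻¹ - 1)⁻¹) *ᵥ
      deltaIntegral 𝕋 (fun u => (transitionMatrix 𝕋 A (forwardJump 𝕋 u) t₀)⁻¹ *ᵥ
        (A u *ᵥ Q u (x (δm s u)) + G u (x u) (x (δm s u)))) t (δp T t)

end

noncomputable section

/-! ## The forward jump operator -/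

/-! Put `w(t) = x(t) - Q(t, x(δ₋(s,t)))`. The neutral equation becomes `w^Δ = A w + h` with `h = A Q
+ G`. Along `p = δ₊^T` one has `w ∘ p = w`, `p' • (h ∘ p) = h` and `p' • (A ∘ p) = A`. So everything
reduces to `IsOpenFinalSegment.periodic_solution_iff`, which describes the shift-periodic solutions
of a linear system.

Since `p` commutes with `σ`, the chain rule has its classical form, and it gives `Φ(p t) = Φ(t) Φ(p
t₀)` (`transitionMatrix_shift`). The derivative of `Φ⁻¹ w` is `k = Φ⁻¹(σ) h`. Integrating from `t`
to `p t` yields `M Φ⁻¹(t) w(t) = ∫ k` with `M = Φ⁻¹(p t₀) - I`. Conversely `M⁻¹ ∫_t^{p t} k` has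
derivative `k`, so `Φ` times it solves the system. `M` is invertible because a kernel vector `v`
would give the nonzero periodic solution `Φ v` of the homogeneous system (`IsNoncritical.isUnit`).

Two preparations carry most of the length. The calculus, with Peano-Baker series and adjoint system,
is built on time scales with a least point, and is moved to `𝕋*`, which has none, by truncating at
`𝕋 ∩ [a, ∞)`. The continuity of `t ↦ δ₋(s,t)`, without which the coefficients along `x` need not be
rd-continuous, is derived from the shift axioms: the map is a strictly increasing bijection of `𝕋*`
(`strictMonoOn_delay`, `surjOn_delay`). -/

lemma le_forwardJump (𝕋 : Set ℝ) (t : ℝ) : t ≤ forwardJump 𝕋 t := by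
  unfold forwardJump
  split_ifs with h
  · exact le_csInf h fun r hr => le_of_lt hr.2
  · exact le_rfl

lemma forwardJump_le {𝕋 : Set ℝ} {t r : ℝ} (hr : r ∈ 𝕋) (htr : t < r) : forwardJump 𝕋 t ≤ r := by
  have h : (𝕋 ∩ Ioi t).Nonempty := ⟨r, hr, htr⟩
  rw [forwardJump, if_pos h]
  exact csInf_le ⟨t, fun u hu => le_of_lt hu.2⟩ ⟨hr, htr⟩

lemma forwardJump_mem {𝕋 : Set ℝ} (h𝕋 : IsClosed 𝕋) {t : ℝ} (ht : t ∈ 𝕋) :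
    forwardJump 𝕋 t ∈ 𝕋 := by
  unfold forwardJump
  split_ifs with h
  · exact h𝕋.closure_subset_iff.2 inter_subset_left
      (csInf_mem_closure h ⟨t, fun u hu => le_of_lt hu.2⟩)
  · exact ht

lemma exists_mem_lt_of_forwardJump_lt {𝕋 : Set ℝ} {t r c : ℝ} (hr : r ∈ 𝕋) (htr : t < r)
    (hc : forwardJump 𝕋 t < c) : ∃ u ∈ 𝕋, t < u ∧ u < c := by
  have h : (𝕋 ∩ Ioi t).Nonempty := ⟨r, hr, htr⟩
  rw [forwardJump, if_pos h] at hc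
  obtain ⟨u, hu, huc⟩ := exists_lt_of_csInf_lt h hc
  exact ⟨u, hu.1, hu.2, huc⟩

lemma forwardJump_inter_Ici {𝕋 : Set ℝ} {a t : ℝ} (hat : a ≤ t) :
    forwardJump (𝕋 ∩ Ici a) t = forwardJump 𝕋 t := by
  have : 𝕋 ∩ Ici a ∩ Ioi t = 𝕋 ∩ Ioi t := by
    ext u
    simp only [mem_inter_iff, mem_Ici, mem_Ioi]
    constructor
    · tauto
    · rintro ⟨h1, h2⟩
      exact ⟨⟨h1, hat.trans h2.le⟩, h2⟩
  unfold forwardJump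
  rw [this]

lemma tendsto_forwardJump_left {𝕋 : Set ℝ} (h𝕋 : IsClosed 𝕋) {t : ℝ} (ht : t ∈ 𝕋) :
    Tendsto (forwardJump 𝕋) (𝓝[𝕋 ∩ Iio t] t) (𝓝[𝕋] t) := by
  refine tendsto_nhdsWithin_iff.2 ⟨?_, ?_⟩
  · refine tendsto_of_tendsto_of_tendsto_of_le_of_le' (g := id) (h := fun _ => t)
      (tendsto_id.mono_left nhdsWithin_le_nhds) tendsto_const_nhds ?_ ?_
    · exact Eventually.of_forall fun r => le_forwardJump 𝕋 r
    · exact eventually_nhdsWithin_of_forall fun r hr => forwardJump_le ht hr.2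
  · exact eventually_nhdsWithin_of_forall fun r hr => forwardJump_mem h𝕋 hr.1

lemma tendsto_forwardJump_of_dense {𝕋 : Set ℝ} (h𝕋 : IsClosed 𝕋) {t : ℝ} (ht : t ∈ 𝕋)
    (hσ : forwardJump 𝕋 t = t) : Tendsto (forwardJump 𝕋) (𝓝[𝕋] t) (𝓝[𝕋] t) := by
  refine tendsto_nhdsWithin_iff.2
    ⟨?_, eventually_nhdsWithin_of_forall fun r hr => forwardJump_mem h𝕋 hr⟩
  refine tendsto_order.2 ⟨fun c hc => ?_, fun c hc => ?_⟩
  · filter_upwards [nhdsWithin_le_nhds (Ioi_mem_nhds hc)] with r hr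
    exact lt_of_lt_of_le hr (le_forwardJump 𝕋 r)
  · by_cases h : ∃ r ∈ 𝕋, t < r
    · obtain ⟨r, hr, htr⟩ := h
      obtain ⟨u, hu, htu, huc⟩ := exists_mem_lt_of_forwardJump_lt hr htr (hσ.trans_lt hc)
      filter_upwards [nhdsWithin_le_nhds (Iio_mem_nhds htu)] with w hw
      exact (forwardJump_le hu hw).trans_lt huc
    · push Not at h
      filter_upwards [self_mem_nhdsWithin] with w hw
      rcases (h w hw).lt_or_eq with h1 | h1
      · exact (forwardJump_le ht h1).trans_lt hc
      · rw [h1, hσ]; exact hc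

/-! ## Delta derivatives -/

section deriv

variable {E F G : Type*} [NormedAddCommGroup E] [NormedSpace ℝ E] [NormedAddCommGroup F]
  [NormedSpace ℝ F] [NormedAddCommGroup G] [NormedSpace ℝ G] {𝕋 : Set ℝ} {t : ℝ}

lemma hasDeltaDeriv_iff_of_dense {f : ℝ → E} {f' : E} (hσ : forwardJump 𝕋 t = t) :
    HasDeltaDeriv 𝕋 f f' t ↔ HasDerivWithinAt f f' 𝕋 t := by
  rw [hasDerivWithinAt_iff_isLittleO, Asymptotics.isLittleO_iff]
  simp only [HasDeltaDeriv, hσ]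
  refine forall_congr' fun ε => ?_
  refine imp_congr_right fun hε => ?_
  rw [Metric.nhdsWithin_basis_ball.eventually_iff]
  refine exists_congr fun η => and_congr_right fun hη => ?_
  constructor
  · intro h r hr
    have := h r hr.2 (by simpa [Real.dist_eq] using hr.1)
    rw [← norm_neg, Real.norm_eq_abs (r - t), abs_sub_comm r t]
    have e : -(f r - f t - (r - t) • f') = f t - f r - (t - r) • f' := by module
    rwa [e]
  · intro h r hr hrt
    have := @h r ⟨by simpa [Real.dist_eq] using hrt, hr⟩
    rw [← norm_neg, Real.norm_eq_abs (r - t), abs_sub_comm r t] at this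
    have e : -(f r - f t - (r - t) • f') = f t - f r - (t - r) • f' := by module
    rwa [e] at this

lemma hasDeltaDeriv_iff_of_scattered {f : ℝ → E} {f' : E} (ht : t ∈ 𝕋)
    (hσ : t < forwardJump 𝕋 t) :
    HasDeltaDeriv 𝕋 f f' t ↔ ContinuousWithinAt f 𝕋 t ∧
      f (forwardJump 𝕋 t) = f t + (forwardJump 𝕋 t - t) • f' := by
  set s := forwardJump 𝕋 t with hs
  have hμ : 0 < s - t := sub_pos.2 hσ
  constructor
  · intro h
    have hval : f s = f t + (s - t) • f' := by
      have h0 : ‖f s - f t - (s - t) • f'‖ ≤ 0 := by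
        refine le_of_forall_pos_le_add fun ε hε => ?_
        -- The test point `r = t` is always admissible; with this tolerance the bound there is
        -- exactly `ε`.
        obtain ⟨η, hη, H⟩ := h (ε / (s - t)) (div_pos hε hμ)
        have := H t ht (by simpa using hη)
        rw [← hs, abs_of_pos hμ, div_mul_cancel₀ _ hμ.ne'] at this
        simpa using this
      have := norm_le_zero_iff.1 h0
      rw [sub_sub, sub_eq_zero] at this
      exact this
    refine ⟨?_, hval⟩
    have hlin : Tendsto (fun r : ℝ => (t - r) • f') (𝓝[𝕋] t) (𝓝 0) := by
      have : Continuous fun r : ℝ => (t - r) • f' := by fun_prop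
      simpa using (this.tendsto t).mono_left nhdsWithin_le_nhds
    have hbase : Tendsto (fun r : ℝ => f t - f r - (t - r) • f') (𝓝[𝕋] t) (𝓝 0) := by
      rw [Metric.tendsto_nhds]
      intro ε hε
      obtain ⟨η, hη, H⟩ := h (ε / (2 * (s - t + 1))) (by positivity)
      have h1 : ∀ᶠ r in 𝓝[𝕋] t, |r - t| < min η 1 :=
        nhdsWithin_le_nhds (Metric.ball_mem_nhds t (lt_min hη one_pos))
      filter_upwards [h1, self_mem_nhdsWithin] with r hr hr𝕋
      have h2 := H r hr𝕋 (hr.trans_le (min_le_left _ _))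
      rw [← hs, hval] at h2
      have h3 : |s - r| ≤ s - t + 1 := by
        have := abs_lt.1 (hr.trans_le (min_le_right _ _))
        rw [abs_le]; constructor <;> linarith
      rw [dist_zero_right]
      have h4 : f t - f r - (t - r) • f' = f t + (s - t) • f' - f r - (s - r) • f' := by
        rw [show s - r = (s - t) + (t - r) by ring, add_smul]; abel
      rw [h4]
      refine h2.trans_lt ?_
      calc ε / (2 * (s - t + 1)) * |s - r| ≤ ε / (2 * (s - t + 1)) * (s - t + 1) := by gcongr
        _ = ε / 2 := by field_simp
        _ < ε := by linarith
    have h5 := (tendsto_const_nhds (x := f t)).sub (hbase.add hlin)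
    simpa [ContinuousWithinAt] using h5
  · rintro ⟨hc, hval⟩ ε hε
    have hcont : Tendsto (fun r => f t - f r - (t - r) • f') (𝓝[𝕋] t) (𝓝 0) := by
      have hlin : Tendsto (fun r : ℝ => (t - r) • f') (𝓝[𝕋] t) (𝓝 0) := by
        have : Continuous fun r : ℝ => (t - r) • f' := by fun_prop
        simpa using (this.tendsto t).mono_left nhdsWithin_le_nhds
      simpa using ((tendsto_const_nhds (x := f t)).sub hc.tendsto).sub hlin
    have h1 := (Metric.tendsto_nhds.1 hcont) (ε * ((s - t) / 2)) (by positivity)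
    rw [Metric.nhdsWithin_basis_ball.eventually_iff] at h1
    obtain ⟨η, hη, H⟩ := h1
    refine ⟨min η ((s - t) / 2), lt_min hη (by positivity), fun r hr hrt => ?_⟩
    have h2 := @H r ⟨by simpa [Real.dist_eq] using hrt.trans_le (min_le_left _ _), hr⟩
    rw [dist_zero_right] at h2
    rw [← hs, hval]
    have h4 : f t - f r - (t - r) • f' = f t + (s - t) • f' - f r - (s - r) • f' := by
      rw [show s - r = (s - t) + (t - r) by ring, add_smul]; abel
    rw [← h4]
    refine h2.le.trans ?_
    have := abs_lt.1 (hrt.trans_le (min_le_right _ _))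
    have h5 : (s - t) / 2 ≤ |s - r| := le_trans (by linarith) (le_abs_self _)
    gcongr

/-- One criterion for dense and scattered points, from which the calculus rules follow: the value
condition is empty at a right-dense point, the derivative condition at a right-scattered one. -/
lemma hasDeltaDeriv_iff {f : ℝ → E} {f' : E} (ht : t ∈ 𝕋) :
    HasDeltaDeriv 𝕋 f f' t ↔ ContinuousWithinAt f 𝕋 t ∧
      f (forwardJump 𝕋 t) = f t + (forwardJump 𝕋 t - t) • f' ∧
      (forwardJump 𝕋 t = t → HasDerivWithinAt f f' 𝕋 t) := by
  rcases (le_forwardJump 𝕋 t).eq_or_lt with h | h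
  · rw [hasDeltaDeriv_iff_of_dense h.symm]
    constructor
    · intro H
      refine ⟨H.continuousWithinAt, ?_, fun _ => H⟩
      rw [← h]; simp
    · intro H
      exact H.2.2 h.symm
  · rw [hasDeltaDeriv_iff_of_scattered ht h]
    exact ⟨fun H => ⟨H.1, H.2, fun h' => absurd h' h.ne'⟩, fun H => ⟨H.1, H.2.1⟩⟩

lemma HasDeltaDeriv.continuousWithinAt {f : ℝ → E} {f' : E} (h : HasDeltaDeriv 𝕋 f f' t)
    (ht : t ∈ 𝕋) : ContinuousWithinAt f 𝕋 t :=
  ((hasDeltaDeriv_iff ht).1 h).1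

lemma HasDeltaDeriv.apply_forwardJump {f : ℝ → E} {f' : E} (h : HasDeltaDeriv 𝕋 f f' t)
    (ht : t ∈ 𝕋) : f (forwardJump 𝕋 t) = f t + graininess 𝕋 t • f' :=
  ((hasDeltaDeriv_iff ht).1 h).2.1

lemma HasDeltaDeriv.bilinear (B : E →L[ℝ] F →L[ℝ] G) {f : ℝ → E} {f' : E} {g : ℝ → F} {g' : F}
    (hf : HasDeltaDeriv 𝕋 f f' t) (hg : HasDeltaDeriv 𝕋 g g' t) (ht : t ∈ 𝕋) :
    HasDeltaDeriv 𝕋 (fun r => B (f r) (g r)) (B f' (g t) + B (f (forwardJump 𝕋 t)) g') t := by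
  rw [hasDeltaDeriv_iff ht] at *
  obtain ⟨f1, f2, f3⟩ := hf
  obtain ⟨g1, g2, g3⟩ := hg
  refine ⟨?_, ?_, fun h => ?_⟩
  · exact (B.continuous.continuousAt.comp_continuousWithinAt f1).clm_apply g1
  · simp only [f2, g2, map_add, map_smul, _root_.add_apply,
      _root_.smul_apply, smul_add, smul_smul]
    abel
  · have := B.hasDerivWithinAt_of_bilinear (f3 h) (g3 h)
    rw [h, add_comm]
    exact this

lemma HasDeltaDeriv.clm (L : E →L[ℝ] F) {f : ℝ → E} {f' : E} (hf : HasDeltaDeriv 𝕋 f f' t)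
    (ht : t ∈ 𝕋) : HasDeltaDeriv 𝕋 (fun r => L (f r)) (L f') t := by
  rw [hasDeltaDeriv_iff ht] at *
  obtain ⟨f1, f2, f3⟩ := hf
  refine ⟨L.continuous.continuousAt.comp_continuousWithinAt f1, by simp [f2], fun h => ?_⟩
  exact L.hasFDerivAt.comp_hasDerivWithinAt t (f3 h)

lemma HasDeltaDeriv.add {f g : ℝ → E} {f' g' : E} (hf : HasDeltaDeriv 𝕋 f f' t)
    (hg : HasDeltaDeriv 𝕋 g g' t) (ht : t ∈ 𝕋) :
    HasDeltaDeriv 𝕋 (fun r => f r + g r) (f' + g') t := by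
  rw [hasDeltaDeriv_iff ht] at *
  refine ⟨hf.1.add hg.1, ?_, fun h => (hf.2.2 h).add (hg.2.2 h)⟩
  rw [hf.2.1, hg.2.1, smul_add]; abel

lemma HasDeltaDeriv.sub {f g : ℝ → E} {f' g' : E} (hf : HasDeltaDeriv 𝕋 f f' t)
    (hg : HasDeltaDeriv 𝕋 g g' t) (ht : t ∈ 𝕋) :
    HasDeltaDeriv 𝕋 (fun r => f r - g r) (f' - g') t := by
  rw [hasDeltaDeriv_iff ht] at *
  refine ⟨hf.1.sub hg.1, ?_, fun h => (hf.2.2 h).sub (hg.2.2 h)⟩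
  rw [hf.2.1, hg.2.1, smul_sub]; abel

lemma hasDeltaDeriv_const (c : E) (ht : t ∈ 𝕋) : HasDeltaDeriv 𝕋 (fun _ => c) 0 t := by
  rw [hasDeltaDeriv_iff ht]
  exact ⟨continuousWithinAt_const, by simp, fun _ => hasDerivWithinAt_const _ _ _⟩

lemma HasDeltaDeriv.congr_of_eventuallyEq {f g : ℝ → E} {f' : E} (hf : HasDeltaDeriv 𝕋 f f' t)
    (ht : t ∈ 𝕋) (h : g =ᶠ[𝓝[𝕋] t] f) (hσ : g (forwardJump 𝕋 t) = f (forwardJump 𝕋 t)) :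
    HasDeltaDeriv 𝕋 g f' t := by
  rw [hasDeltaDeriv_iff ht] at *
  have h0 : g t = f t := h.eq_of_nhdsWithin ht
  refine ⟨hf.1.congr_of_eventuallyEq h h0, by rw [hσ, h0, hf.2.1], fun hh => ?_⟩
  exact (hf.2.2 hh).congr_of_eventuallyEq h h0

lemma nhdsWithin_inter_Ici_of_lt {a : ℝ} (hat : a < t) : 𝓝[𝕋 ∩ Ici a] t = 𝓝[𝕋] t :=
  nhdsWithin_inter_of_mem' (nhdsWithin_le_nhds (Ici_mem_nhds hat))

lemma HasDeltaDeriv.mono_Ici {a b : ℝ} {f : ℝ → E} {f' : E}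
    (hf : HasDeltaDeriv (𝕋 ∩ Ici a) f f' t) (hab : a ≤ b) (ht : t ∈ 𝕋) (hbt : b ≤ t) :
    HasDeltaDeriv (𝕋 ∩ Ici b) f f' t := by
  rw [hasDeltaDeriv_iff (show t ∈ 𝕋 ∩ Ici b from ⟨ht, hbt⟩), forwardJump_inter_Ici hbt]
  rw [hasDeltaDeriv_iff (show t ∈ 𝕋 ∩ Ici a from ⟨ht, hab.trans hbt⟩), forwardJump_inter_Ici (hab.trans hbt)] at hf
  have hsub : 𝕋 ∩ Ici b ⊆ 𝕋 ∩ Ici a := inter_subset_inter_right _ (Ici_subset_Ici.2 hab)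
  exact ⟨hf.1.mono hsub, hf.2.1, fun h => (hf.2.2 h).mono hsub⟩

lemma HasDeltaDeriv.inter_Ici {a : ℝ} {f : ℝ → E} {f' : E}
    (hf : HasDeltaDeriv 𝕋 f f' t) (ht : t ∈ 𝕋) (hat : a ≤ t) :
    HasDeltaDeriv (𝕋 ∩ Ici a) f f' t := by
  rw [hasDeltaDeriv_iff (show t ∈ 𝕋 ∩ Ici a from ⟨ht, hat⟩), forwardJump_inter_Ici hat]
  rw [hasDeltaDeriv_iff ht] at hf
  exact ⟨hf.1.mono inter_subset_left, hf.2.1, fun h => (hf.2.2 h).mono inter_subset_left⟩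

/-- The inequality `a < t` is strict because truncation at `t` itself would discard the left
neighbours of `t`. -/
lemma HasDeltaDeriv.of_inter_Ici {a : ℝ} {f : ℝ → E} {f' : E}
    (hf : HasDeltaDeriv (𝕋 ∩ Ici a) f f' t) (ht : t ∈ 𝕋) (hat : a < t) :
    HasDeltaDeriv 𝕋 f f' t := by
  rw [hasDeltaDeriv_iff (show t ∈ 𝕋 ∩ Ici a from ⟨ht, hat.le⟩), forwardJump_inter_Ici hat.le] at hf
  rw [hasDeltaDeriv_iff ht]
  have h := nhdsWithin_inter_Ici_of_lt (𝕋 := 𝕋) hat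
  refine ⟨?_, hf.2.1, fun hh => ?_⟩
  · have := hf.1
    rwa [ContinuousWithinAt, h] at this
  · exact (hf.2.2 hh).mono_of_mem_nhdsWithin (h ▸ self_mem_nhdsWithin)

end deriv

/-! ## rd-continuous functions -/

section rd

variable {E F G : Type*} [TopologicalSpace E] [TopologicalSpace F] [TopologicalSpace G]
  {𝕋 S : Set ℝ}

lemma RdContinuousOn.map {f : ℝ → E} (hf : RdContinuousOn 𝕋 S f) {φ : E → F}
    (hφ : Continuous φ) : RdContinuousOn 𝕋 S fun t => φ (f t) := by
  intro t ht
  obtain ⟨h1, l, h2⟩ := hf t ht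
  exact ⟨fun h => hφ.continuousAt.comp_continuousWithinAt (h1 h), φ l, (hφ.tendsto l).comp h2⟩

lemma RdContinuousOn.map₂ {f : ℝ → E} {g : ℝ → F} (hf : RdContinuousOn 𝕋 S f)
    (hg : RdContinuousOn 𝕋 S g) {φ : E → F → G} (hφ : Continuous fun q : E × F => φ q.1 q.2) :
    RdContinuousOn 𝕋 S fun t => φ (f t) (g t) := by
  intro t ht
  obtain ⟨f1, l, f2⟩ := hf t ht
  obtain ⟨g1, m, g2⟩ := hg t ht
  exact ⟨fun h => hφ.continuousAt.comp_continuousWithinAt ((f1 h).prodMk (g1 h)), φ l m,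
    (hφ.tendsto (l, m)).comp (f2.prodMk_nhds g2)⟩

lemma rdContinuousOn_of_continuousWithinAt {f : ℝ → E}
    (hf : ∀ t ∈ S, ContinuousWithinAt f 𝕋 t) : RdContinuousOn 𝕋 S f := fun t ht =>
  ⟨fun _ => hf t ht, f t, (hf t ht).mono_left (nhdsWithin_mono _ inter_subset_left)⟩

/-- For `r < t` one has `r ≤ σ(r) ≤ t`, so `σ(r) → t` as `r ↑ t`: the left limit is `f t`, even
where `σ(t) > t`. -/
lemma rdContinuousOn_comp_forwardJump (h𝕋 : IsClosed 𝕋) (hS : S ⊆ 𝕋) {f : ℝ → E}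
    (hf : ∀ t ∈ S, ContinuousWithinAt f 𝕋 t) :
    RdContinuousOn 𝕋 S fun t => f (forwardJump 𝕋 t) := by
  intro t ht
  refine ⟨fun h => ?_, f t, (hf t ht).tendsto.comp (tendsto_forwardJump_left h𝕋 (hS ht))⟩
  have := (hf t ht).tendsto.comp (tendsto_forwardJump_of_dense h𝕋 (hS ht) h)
  simpa [ContinuousWithinAt, h, Function.comp_def] using this

lemma RdContinuousOn.inter_Ici {f : ℝ → E} (hf : RdContinuousOn 𝕋 S f) {a : ℝ}
    (ha : 𝕋 ∩ Ici a ⊆ S) : RdContinuousOn (𝕋 ∩ Ici a) (𝕋 ∩ Ici a) f := by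
  intro t ht
  obtain ⟨f1, l, f2⟩ := hf t (ha ht)
  rw [forwardJump_inter_Ici ht.2]
  refine ⟨fun h => (f1 h).mono inter_subset_left, l, f2.mono_left (nhdsWithin_mono _ ?_)⟩
  exact inter_subset_inter_left _ inter_subset_left

end rd

/-! ## Extension of functions on a time scale to the gaps -/

/-- The last point of the time scale that is at most `u`. -/
def timeScaleFloor (𝕋 : Set ℝ) (u : ℝ) : ℝ := sSup (𝕋 ∩ Iic u)

section floor

variable {𝕋 : Set ℝ} {a t u v : ℝ}

lemma timeScaleFloor_of_mem (ht : t ∈ 𝕋) : timeScaleFloor 𝕋 t = t :=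
  IsGreatest.csSup_eq ⟨⟨ht, self_mem_Iic⟩, fun _ hr => hr.2⟩

lemma le_timeScaleFloor (ht : t ∈ 𝕋) (htu : t ≤ u) : t ≤ timeScaleFloor 𝕋 u :=
  le_csSup ⟨u, fun _ hr => hr.2⟩ ⟨ht, htu⟩

lemma timeScaleFloor_le (ht : t ∈ 𝕋) (htu : t ≤ u) : timeScaleFloor 𝕋 u ≤ u :=
  csSup_le ⟨t, ht, htu⟩ fun _ hr => hr.2

lemma timeScaleFloor_mem (h𝕋 : IsClosed 𝕋) (ht : t ∈ 𝕋) (htu : t ≤ u) :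
    timeScaleFloor 𝕋 u ∈ 𝕋 :=
  h𝕋.closure_subset_iff.2 inter_subset_left
    (csSup_mem_closure ⟨t, ht, htu⟩ ⟨u, fun _ hr => hr.2⟩)

lemma timeScaleFloor_eq (ht : t ∈ 𝕋) (htu : t ≤ u) (h : ∀ r ∈ 𝕋, r ≤ u → r ≤ t) :
    timeScaleFloor 𝕋 u = t :=
  IsGreatest.csSup_eq ⟨⟨ht, htu⟩, fun r hr => h r hr.1 hr.2⟩

lemma timeScaleFloor_eq_of_lt_forwardJump (ht : t ∈ 𝕋) (htu : t ≤ u) (hu : u < forwardJump 𝕋 t) :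
    timeScaleFloor 𝕋 u = t :=
  timeScaleFloor_eq ht htu fun r hr hru => by
    by_contra! h
    exact absurd (forwardJump_le hr h) (not_le.2 (hru.trans_lt hu))

lemma timeScaleFloor_inter_Ici (ht : a ∈ 𝕋) (hau : a ≤ u) :
    timeScaleFloor (𝕋 ∩ Ici a) u = timeScaleFloor 𝕋 u := by
  have hne : (𝕋 ∩ Ici a ∩ Iic u).Nonempty := ⟨a, ⟨ht, self_mem_Ici⟩, hau⟩
  refine le_antisymm (csSup_le_csSup ⟨u, fun _ hr => hr.2⟩ hne ?_) ?_
  · exact inter_subset_inter_left _ inter_subset_left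
  · refine csSup_le ⟨a, ht, hau⟩ fun r hr => ?_
    rcases le_total a r with h | h
    · exact le_csSup ⟨u, fun _ hr => hr.2⟩ ⟨⟨hr.1, h⟩, hr.2⟩
    · exact h.trans (le_csSup ⟨u, fun _ hr => hr.2⟩ ⟨⟨ht, self_mem_Ici⟩, hau⟩)

lemma eventually_timeScaleFloor_eq (h𝕋 : IsClosed 𝕋) (hu : u ∉ 𝕋) :
    ∀ᶠ v in 𝓝 u, timeScaleFloor 𝕋 v = timeScaleFloor 𝕋 u := by
  obtain ⟨ε, hε, hb⟩ := Metric.isOpen_iff.1 h𝕋.isOpen_compl u hu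
  filter_upwards [Metric.ball_mem_nhds u hε] with v hv
  have : 𝕋 ∩ Iic v = 𝕋 ∩ Iic u := by
    ext r
    simp only [mem_inter_iff, mem_Iic]
    refine and_congr_right fun hr => ?_
    have h1 : ¬ |r - u| < ε := fun h => hb (by simpa [Real.dist_eq] using h) hr
    have h2 : |v - u| < ε := by simpa [Real.dist_eq] using hv
    rw [abs_lt] at h1 h2
    constructor
    · intro h
      by_contra! h'
      exact h1 ⟨by linarith, by linarith⟩
    · intro h
      by_contra! h'
      exact h1 ⟨by linarith, by linarith⟩
  simp only [timeScaleFloor, this]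

lemma tendsto_timeScaleFloor_right (h𝕋 : IsClosed 𝕋) (ht : t ∈ 𝕋) :
    Tendsto (timeScaleFloor 𝕋) (𝓝[Ici t] t) (𝓝[𝕋] t) := by
  refine tendsto_nhdsWithin_iff.2
    ⟨?_, eventually_nhdsWithin_of_forall fun r hr => timeScaleFloor_mem h𝕋 ht hr⟩
  refine tendsto_of_tendsto_of_tendsto_of_le_of_le' (g := fun _ => t) (h := id)
    tendsto_const_nhds (tendsto_id.mono_left nhdsWithin_le_nhds) ?_ ?_
  · exact eventually_nhdsWithin_of_forall fun r hr => le_timeScaleFloor ht hr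
  · exact eventually_nhdsWithin_of_forall fun r hr => timeScaleFloor_le ht hr

end floor

/-! ### Right-continuity, boundedness and integrability of the extension of an rd-continuous
function. -/

section cadlag

variable {E : Type*} [NormedAddCommGroup E] {𝕋 : Set ℝ} {a b : ℝ} {f : ℝ → E}

/-- The floor is locally constant off `𝕋` and constant on `[u, σ(u))`; at a right-dense `u` it tends
to `u` from the right. Right-continuity then supplies measurability. -/
lemma RdContinuousOn.continuousWithinAt_floor (hf : RdContinuousOn 𝕋 𝕋 f) (h𝕋 : IsClosed 𝕋)
    {u : ℝ} : ContinuousWithinAt (fun v => f (timeScaleFloor 𝕋 v)) (Ici u) u := by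
  by_cases hu : u ∈ 𝕋
  · rcases (le_forwardJump 𝕋 u).eq_or_lt with h | h
    · have := ((hf u hu).1 h.symm).tendsto.comp (tendsto_timeScaleFloor_right h𝕋 hu)
      simpa [ContinuousWithinAt, timeScaleFloor_of_mem hu, Function.comp_def] using this
    · refine (continuousWithinAt_const (b := f u)).congr_of_eventuallyEq ?_ ?_
      · filter_upwards [self_mem_nhdsWithin, nhdsWithin_le_nhds (Iio_mem_nhds h)] with v hv hv'
        rw [timeScaleFloor_eq_of_lt_forwardJump hu hv hv']
      · rw [timeScaleFloor_of_mem hu]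
  · refine (continuousWithinAt_const (b := f (timeScaleFloor 𝕋 u))).congr_of_eventuallyEq ?_ rfl
    filter_upwards [nhdsWithin_le_nhds (eventually_timeScaleFloor_eq h𝕋 hu)] with v hv
    rw [hv]

lemma RdContinuousOn.exists_bound {S : Set ℝ} (hf : RdContinuousOn 𝕋 S f) (hS : S ⊆ 𝕋) {K : Set ℝ}
    (hK : IsCompact K) (hKS : K ⊆ S) : ∃ C, 0 ≤ C ∧ ∀ t ∈ K, ‖f t‖ ≤ C := by
  refine hK.induction_on (p := fun s => ∃ C, 0 ≤ C ∧ ∀ t ∈ s, ‖f t‖ ≤ C) ⟨0, le_rfl, by simp⟩ ?_ ?_ ?_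
  · rintro s t hst ⟨C, h0, hC⟩
    exact ⟨C, h0, fun r hr => hC r (hst hr)⟩
  · rintro s t ⟨C, h0, hC⟩ ⟨D, -, hD⟩
    refine ⟨max C D, le_max_of_le_left h0, ?_⟩
    rintro r (hr | hr)
    · exact (hC r hr).trans (le_max_left _ _)
    · exact (hD r hr).trans (le_max_right _ _)
  · intro t ht
    obtain ⟨h1, l, h2⟩ := hf t (hKS ht)
    have hleft : ∀ᶠ r in 𝓝[𝕋 ∩ Iio t] t, ‖f r‖ < ‖l‖ + 1 :=
      h2.norm.eventually_lt_const (lt_add_one _)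
    have hright : ∀ᶠ r in 𝓝[𝕋 ∩ Ioi t] t, ‖f r‖ < ‖f t‖ + 1 := by
      rcases (le_forwardJump 𝕋 t).eq_or_lt with h | h
      · exact ((h1 h.symm).tendsto.norm.eventually_lt_const (lt_add_one _)).filter_mono
          (nhdsWithin_mono _ inter_subset_left)
      · filter_upwards [self_mem_nhdsWithin, nhdsWithin_le_nhds (Iio_mem_nhds h)] with r hr hr'
        exact absurd (forwardJump_le hr.1 hr.2) (not_le.2 hr')
    rw [eventually_nhdsWithin_iff] at hleft hright
    refine ⟨K ∩ {r | ‖f r‖ ≤ max (‖l‖ + 1) (‖f t‖ + 1)}, ?_, max (‖l‖ + 1) (‖f t‖ + 1),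
      by positivity, fun r hr => hr.2⟩
    filter_upwards [self_mem_nhdsWithin, nhdsWithin_le_nhds hleft, nhdsWithin_le_nhds hright]
      with r hr hl hr'
    refine ⟨hr, ?_⟩
    rcases lt_trichotomy r t with h | h | h
    · exact (hl ⟨hS (hKS hr), h⟩).le.trans (le_max_left _ _)
    · rw [mem_ofPred_eq, h]
      exact le_trans (by linarith) (le_max_right _ _)
    · exact (hr' ⟨hS (hKS hr), h⟩).le.trans (le_max_right _ _)

open MeasureTheory in
/-- A right-continuous function on the line is strongly measurable. -/
lemma stronglyMeasurable_of_continuousWithinAt_Ici {g : ℝ → E}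
    (hg : ∀ u, ContinuousWithinAt g (Ici u) u) : StronglyMeasurable g := by
  -- The first point strictly above `u` of the grid of mesh `1/(n+1)`. It tends to `u` from the
  -- right, and `g (r n u)` depends only on an integer, hence is measurable in `u`.
  let r : ℕ → ℝ → ℝ := fun n u => ((⌊((n : ℝ) + 1) * u⌋ : ℝ) + 1) / ((n : ℝ) + 1)
  have hlow : ∀ n u, u ≤ r n u := fun n u => by
    rw [le_div_iff₀ (by positivity), mul_comm]
    exact (Int.lt_floor_add_one _).le
  have hup : ∀ n u, r n u ≤ u + 1 / ((n : ℝ) + 1) := fun n u => by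
    have hpos : (0 : ℝ) < (n : ℝ) + 1 := by positivity
    have h := Int.floor_le (((n : ℝ) + 1) * u)
    rw [div_le_iff₀ hpos, add_mul u, div_mul_cancel₀ _ hpos.ne', mul_comm u]
    linarith
  refine stronglyMeasurable_of_tendsto atTop (f := fun n u => g (r n u)) (fun n => ?_) ?_
  · have h1 : StronglyMeasurable fun k : ℤ => g (((k : ℝ) + 1) / ((n : ℝ) + 1)) :=
      .of_discrete
    exact h1.comp_measurable (g := fun u : ℝ => ⌊((n : ℝ) + 1) * u⌋)
      (Int.measurable_floor.comp (measurable_const.mul measurable_id))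
  · rw [tendsto_pi_nhds]
    intro u
    refine (hg u).tendsto.comp (tendsto_nhdsWithin_iff.2 ⟨?_, Eventually.of_forall fun n => hlow n u⟩)
    refine tendsto_of_tendsto_of_tendsto_of_le_of_le tendsto_const_nhds ?_ (fun n => hlow n u)
      (fun n => hup n u)
    simpa using (tendsto_const_nhds (x := u)).add (tendsto_one_div_add_atTop_nhds_zero_nat (𝕜 := ℝ))

lemma RdContinuousOn.intervalIntegrable_floor (hf : RdContinuousOn 𝕋 𝕋 f) (h𝕋 : IsClosed 𝕋)
    (ha : IsLeast 𝕋 a) {c d : ℝ} (hc : a ≤ c) (hd : a ≤ d) :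
    IntervalIntegrable (fun u => f (timeScaleFloor 𝕋 u)) MeasureTheory.volume c d := by
  have hm : MeasureTheory.StronglyMeasurable fun u => f (timeScaleFloor 𝕋 u) :=
    stronglyMeasurable_of_continuousWithinAt_Ici fun u => hf.continuousWithinAt_floor h𝕋
  obtain ⟨C, -, hC⟩ := hf.exists_bound subset_rfl
    ((isCompact_Icc (a := a) (b := max c d)).inter_left h𝕋) inter_subset_left
  rw [intervalIntegrable_iff]
  refine MeasureTheory.Measure.integrableOn_of_bounded (M := C) (by simp) hm.aestronglyMeasurable ?_
  refine (MeasureTheory.ae_restrict_iff' measurableSet_uIoc).2 (Eventually.of_forall fun u hu => ?_)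
  have hu1 : a ≤ u := (le_min hc hd).trans hu.1.le
  exact hC _ ⟨timeScaleFloor_mem h𝕋 ha.1 hu1, le_timeScaleFloor ha.1 hu1,
    (timeScaleFloor_le ha.1 hu1).trans hu.2⟩

end cadlag

/-! ### The fundamental theorem of calculus for the delta integral. -/

section ftc

variable {E : Type*} [NormedAddCommGroup E] [NormedSpace ℝ E] {𝕋 : Set ℝ} {a b : ℝ} {f : ℝ → E}

lemma continuousOn_deltaIntegral (hf : RdContinuousOn 𝕋 𝕋 f) (h𝕋 : IsClosed 𝕋)
    (ha : IsLeast 𝕋 a) : ContinuousOn (deltaIntegral 𝕋 f a) (Ici a) := by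
  intro t ht
  have h := intervalIntegral.continuousOn_primitive_interval'
    (hf.intervalIntegrable_floor h𝕋 ha le_rfl (le_trans ht (le_add_of_nonneg_right zero_le_one)))
    left_mem_uIcc
  rw [uIcc_of_le (le_trans ht (le_add_of_nonneg_right zero_le_one))] at h
  refine (h t ⟨ht, by linarith⟩).mono_of_mem_nhdsWithin ?_
  filter_upwards [self_mem_nhdsWithin, nhdsWithin_le_nhds (Iio_mem_nhds (lt_add_one t))] with v hv hv'
  exact ⟨hv, hv'.le⟩

lemma hasDeltaDeriv_deltaIntegral [CompleteSpace E] (hf : RdContinuousOn 𝕋 𝕋 f) (h𝕋 : IsClosed 𝕋)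
    (ha : IsLeast 𝕋 a) {t : ℝ} (ht : t ∈ 𝕋) : HasDeltaDeriv 𝕋 (deltaIntegral 𝕋 f a) (f t) t := by
  have hint : ∀ {c d}, a ≤ c → a ≤ d → IntervalIntegrable (fun u => f (timeScaleFloor 𝕋 u))
    MeasureTheory.volume c d := fun hc hd => hf.intervalIntegrable_floor h𝕋 ha hc hd
  have hsub : ∀ r ∈ 𝕋, deltaIntegral 𝕋 f a r - deltaIntegral 𝕋 f a t =
      ∫ u in t..r, f (timeScaleFloor 𝕋 u) := fun r hr =>
    intervalIntegral.integral_interval_sub_left (hint le_rfl (ha.2 hr)) (hint le_rfl (ha.2 ht))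
  have hσ := forwardJump_mem h𝕋 ht
  rw [hasDeltaDeriv_iff ht]
  refine ⟨(continuousOn_deltaIntegral hf h𝕋 ha t (ha.2 ht)).mono fun r hr => ha.2 hr, ?_, fun h => ?_⟩
  · rw [← sub_eq_iff_eq_add', hsub _ hσ]
    rw [intervalIntegral.integral_congr_Ioo_of_le (g := fun _ => f t) (le_forwardJump 𝕋 t)
      fun u hu => by simp only [timeScaleFloor_eq_of_lt_forwardJump ht hu.1.le hu.2]]
    simp
  · rw [hasDerivWithinAt_iff_isLittleO, Asymptotics.isLittleO_iff]
    intro ε hε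
    have hc := Metric.continuousWithinAt_iff.1 ((hf t ht).1 h) ε hε
    obtain ⟨η, hη, H⟩ := hc
    filter_upwards [self_mem_nhdsWithin, nhdsWithin_le_nhds (Metric.ball_mem_nhds t hη)] with r hr hrη
    rw [hsub r hr]
    have hconst : (r - t) • f t = ∫ u in t..r, f t := by simp
    rw [hconst, ← intervalIntegral.integral_sub (hint (ha.2 ht) (ha.2 hr)) (by simp)]
    refine intervalIntegral.norm_integral_le_of_norm_le_const fun u hu => ?_
    -- The floor of a point between `t` and `r` stays between them, hence within `η` of `t`.
    have hmin : min t r ∈ 𝕋 := by rcases min_choice t r with e | e <;> rw [e] <;> assumption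
    have h1 := le_timeScaleFloor hmin hu.1.le
    have h2 := (timeScaleFloor_le hmin hu.1.le).trans hu.2
    rw [← dist_eq_norm]
    refine (H (timeScaleFloor_mem h𝕋 hmin hu.1.le) ?_).le
    rw [Metric.mem_ball, Real.dist_eq, abs_lt] at hrη
    rw [Real.dist_eq, abs_lt]
    constructor
    · rcases min_choice t r with e | e <;> rw [e] at h1 <;> linarith
    · rcases max_choice t r with e | e <;> rw [e] at h2 <;> linarith

/-- A function with vanishing delta derivative is constant. -/
lemma eq_of_hasDeltaDeriv_zero (h𝕋 : IsClosed 𝕋) (ha : IsLeast 𝕋 a)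
    (hf : ∀ t ∈ 𝕋, HasDeltaDeriv 𝕋 f 0 t) {t : ℝ} (ht : t ∈ 𝕋) : f t = f a := by
  have hc : ∀ t ∈ 𝕋, ContinuousWithinAt f 𝕋 t := fun t ht => (hf t ht).continuousWithinAt ht
  have hrd : RdContinuousOn 𝕋 𝕋 f := rdContinuousOn_of_continuousWithinAt hc
  have hright : ∀ u, ContinuousWithinAt (fun v => f (timeScaleFloor 𝕋 v)) (Ici u) u :=
    fun u => hrd.continuousWithinAt_floor h𝕋
  -- The floor extension of `f` is continuous on the real interval and has right derivative zero
  -- there.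
  have key := constant_of_has_deriv_right_zero (a := a) (b := t)
    (f := fun v => f (timeScaleFloor 𝕋 v)) ?_ ?_ t ⟨ha.2 ht, le_rfl⟩
  · simpa [timeScaleFloor_of_mem ht, timeScaleFloor_of_mem ha.1] using key
  · intro u hu
    by_cases hu𝕋 : u ∈ 𝕋
    · have hleft : ContinuousWithinAt (fun v => f (timeScaleFloor 𝕋 v)) (Ico a u) u := by
        by_cases hd : u ∈ closure (𝕋 ∩ Iio u)
        · have htend : Tendsto (timeScaleFloor 𝕋) (𝓝[Ico a u] u) (𝓝[𝕋] u) := by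
            refine tendsto_nhdsWithin_iff.2 ⟨?_, eventually_nhdsWithin_of_forall fun r hr =>
              timeScaleFloor_mem h𝕋 ha.1 hr.1⟩
            refine tendsto_order.2 ⟨fun c hcu => ?_, fun c hcu => ?_⟩
            · obtain ⟨w, hw, hw𝕋⟩ := mem_closure_iff.1 hd (Ioi c) isOpen_Ioi hcu
              filter_upwards [nhdsWithin_le_nhds (Ioi_mem_nhds hw𝕋.2)] with r hr
              exact lt_of_lt_of_le hw (le_timeScaleFloor hw𝕋.1 hr.le)
            · filter_upwards [self_mem_nhdsWithin] with r hr
              exact (timeScaleFloor_le ha.1 hr.1).trans_lt (hr.2.trans hcu)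
          have := (hc u hu𝕋).tendsto.comp htend
          simpa [ContinuousWithinAt, timeScaleFloor_of_mem hu𝕋, Function.comp_def] using this
        · rcases hu.1.eq_or_lt with h | h
          · rw [h]; simp [ContinuousWithinAt]
          · have hne : (𝕋 ∩ Iio u).Nonempty := ⟨a, ha.1, h⟩
            have hbdd : BddAbove (𝕋 ∩ Iio u) := ⟨u, fun _ hr => hr.2.le⟩
            -- At a left-scattered `u`, `w` is its predecessor. The zero derivative at `w` forces `f
            -- u = f w`, so the extension does not jump at the end of the gap.
            set w := sSup (𝕋 ∩ Iio u) with hw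
            have hwc : w ∈ closure (𝕋 ∩ Iio u) := csSup_mem_closure hne hbdd
            have hw𝕋 : w ∈ 𝕋 := h𝕋.closure_subset_iff.2 inter_subset_left hwc
            have hwu : w < u := lt_of_le_of_ne (csSup_le hne fun _ hr => hr.2.le)
              fun e => hd (e ▸ hwc)
            have hσ : forwardJump 𝕋 w = u := by
              refine le_antisymm (forwardJump_le hu𝕋 hwu) ?_
              have hj : (𝕋 ∩ Ioi w).Nonempty := ⟨u, hu𝕋, hwu⟩
              rw [forwardJump, if_pos hj]
              refine le_csInf hj fun r hr => ?_
              by_contra! hru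
              exact absurd (le_csSup hbdd ⟨hr.1, hru⟩) (not_le.2 hr.2)
            have hval : f u = f w := by
              have := (hf w hw𝕋).apply_forwardJump hw𝕋
              rwa [hσ, smul_zero, add_zero] at this
            refine (continuousWithinAt_const (b := f w)).congr_of_eventuallyEq ?_ ?_
            · filter_upwards [self_mem_nhdsWithin, nhdsWithin_le_nhds (Ioi_mem_nhds hwu)] with v hv hv'
              rw [timeScaleFloor_eq_of_lt_forwardJump hw𝕋 hv'.le (hσ.symm ▸ hv.2)]
            · rw [timeScaleFloor_of_mem hu𝕋, hval]
      refine (hleft.union (hright u)).mono fun v hv => ?_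
      rcases lt_or_ge v u with h | h
      · exact Or.inl ⟨hv.1, h⟩
      · exact Or.inr h
    · refine ((continuousAt_const (y := f (timeScaleFloor 𝕋 u))).congr ?_).continuousWithinAt
      filter_upwards [eventually_timeScaleFloor_eq h𝕋 hu𝕋] with v hv
      rw [hv]
  · intro u hu
    by_cases hu𝕋 : u ∈ 𝕋
    · rcases (le_forwardJump 𝕋 u).eq_or_lt with h | h
      · have hd := (hasDeltaDeriv_iff_of_dense h.symm).1 (hf u hu𝕋)
        rw [hasDerivWithinAt_iff_isLittleO] at hd ⊢
        have h2 := hd.comp_tendsto (tendsto_timeScaleFloor_right h𝕋 hu𝕋)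
        simp only [smul_zero, sub_zero, Function.comp_def, timeScaleFloor_of_mem hu𝕋] at h2 ⊢
        -- Since `0 ≤ floor v - u ≤ v - u`, an error `o(floor v - u)` is also `o(v - u)`.
        refine h2.trans_isBigO (Asymptotics.IsBigO.of_bound 1 ?_)
        filter_upwards [self_mem_nhdsWithin] with v hv
        have h3 := le_timeScaleFloor hu𝕋 hv
        have h4 := timeScaleFloor_le hu𝕋 hv
        rw [Real.norm_of_nonneg (sub_nonneg.2 h3), Real.norm_of_nonneg (sub_nonneg.2 hv)]
        linarith
      · refine (hasDerivWithinAt_const u (Ici u) (f u)).congr_of_eventuallyEq ?_ ?_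
        · filter_upwards [self_mem_nhdsWithin, nhdsWithin_le_nhds (Iio_mem_nhds h)] with v hv hv'
          rw [timeScaleFloor_eq_of_lt_forwardJump hu𝕋 hv hv']
        · rw [timeScaleFloor_of_mem hu𝕋]
    · refine (hasDerivWithinAt_const u (Ici u) (f (timeScaleFloor 𝕋 u))).congr_of_eventuallyEq ?_ rfl
      filter_upwards [nhdsWithin_le_nhds (eventually_timeScaleFloor_eq h𝕋 hu𝕋)] with v hv
      rw [hv]

lemma deltaIntegral_inter_Ici (ha : a ∈ 𝕋) (hb : a ≤ b) :
    deltaIntegral (𝕋 ∩ Ici a) f a b = deltaIntegral 𝕋 f a b := by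
  refine intervalIntegral.integral_congr fun u hu => ?_
  rw [uIcc_of_le hb] at hu
  exact congrArg f (timeScaleFloor_inter_Ici ha hu.1)

lemma deltaIntegral_congr {g : ℝ → E} (h𝕋 : IsClosed 𝕋) (ha : a ∈ 𝕋) (hab : a ≤ b)
    (h : ∀ t ∈ 𝕋, a ≤ t → t ≤ b → f t = g t) :
    deltaIntegral 𝕋 f a b = deltaIntegral 𝕋 g a b := by
  refine intervalIntegral.integral_congr fun u hu => ?_
  rw [uIcc_of_le hab] at hu
  exact h _ (timeScaleFloor_mem h𝕋 ha hu.1) (le_timeScaleFloor ha hu.1)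
    ((timeScaleFloor_le ha hu.1).trans hu.2)

end ftc

/-! ## The Peano-Baker series -/

section peanoBaker

open scoped Matrix.Norms.Operator

variable {n : ℕ} {𝕋 : Set ℝ} {A : ℝ → Matrix (Fin n) (Fin n) ℝ} {a b : ℝ}

lemma RdContinuousOn.mul_continuousOn_Ici {P : ℝ → Matrix (Fin n) (Fin n) ℝ}
    (hA : RdContinuousOn 𝕋 𝕋 A) (ha : IsLeast 𝕋 a) (hP : ContinuousOn P (Ici a)) :
    RdContinuousOn 𝕋 𝕋 fun t => A t * P t :=
  hA.map₂ (rdContinuousOn_of_continuousWithinAt fun t ht =>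
    (hP t (ha.2 ht)).mono fun _ hr => ha.2 hr) (φ := fun M N => M * N) continuous_mul

/-- Replaces the entrywise integral in the Peano-Baker terms by a Bochner integral of matrices, to
which norm estimates apply. -/
lemma matrix_of_deltaIntegral {f : ℝ → Matrix (Fin n) (Fin n) ℝ} (hf : RdContinuousOn 𝕋 𝕋 f)
    (h𝕋 : IsClosed 𝕋) (ha : IsLeast 𝕋 a) {t : ℝ} (ht : a ≤ t) :
    (Matrix.of fun i j => deltaIntegral 𝕋 (fun τ => f τ i j) a t) = deltaIntegral 𝕋 f a t := by
  ext i j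
  exact ContinuousLinearMap.intervalIntegral_comp_comm
    (LinearMap.toContinuousLinearMap (Matrix.entryLinearMap ℝ ℝ i j))
    (hf.intervalIntegrable_floor h𝕋 ha le_rfl ht)

lemma peanoBakerTerm_continuousOn (hA : RdContinuousOn 𝕋 𝕋 A) (h𝕋 : IsClosed 𝕋)
    (ha : IsLeast 𝕋 a) (k : ℕ) : ContinuousOn (peanoBakerTerm 𝕋 A a k) (Ici a) := by
  induction k with
  | zero => exact continuousOn_const
  | succ k ih =>
    have h := hA.mul_continuousOn_Ici ha ih
    exact (continuousOn_deltaIntegral h h𝕋 ha).congr fun t ht => matrix_of_deltaIntegral h h𝕋 ha ht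

lemma peanoBakerTerm_succ (hA : RdContinuousOn 𝕋 𝕋 A) (h𝕋 : IsClosed 𝕋) (ha : IsLeast 𝕋 a)
    (k : ℕ) {t : ℝ} (ht : a ≤ t) : peanoBakerTerm 𝕋 A a (k + 1) t =
      deltaIntegral 𝕋 (fun τ => A τ * peanoBakerTerm 𝕋 A a k τ) a t :=
  matrix_of_deltaIntegral (hA.mul_continuousOn_Ici ha (peanoBakerTerm_continuousOn hA h𝕋 ha k))
    h𝕋 ha ht

/-- The classical factorial bound survives on a time scale because `floor u ≤ u`: the extension of
`(τ - a)^k` is at most `(u - a)^k`. -/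
lemma norm_peanoBakerTerm_le (hA : RdContinuousOn 𝕋 𝕋 A) (h𝕋 : IsClosed 𝕋) (ha : IsLeast 𝕋 a)
    {C : ℝ} (hC : ∀ t ∈ 𝕋 ∩ Icc a b, ‖A t‖ ≤ C) (hC0 : 0 ≤ C) (k : ℕ) :
    ∀ t ∈ Icc a b, ‖peanoBakerTerm 𝕋 A a k t‖ ≤
      ‖(1 : Matrix (Fin n) (Fin n) ℝ)‖ * ((C * (t - a)) ^ k / k.factorial) := by
  set D := ‖(1 : Matrix (Fin n) (Fin n) ℝ)‖
  have hD : 0 ≤ D := norm_nonneg _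
  induction k with
  | zero => intro t _; simp [peanoBakerTerm, D]
  | succ k ih =>
    intro t ht
    rw [peanoBakerTerm_succ hA h𝕋 ha k ht.1]
    have hle : ∀ u ∈ Ioc a t, ‖A (timeScaleFloor 𝕋 u) *
        peanoBakerTerm 𝕋 A a k (timeScaleFloor 𝕋 u)‖ ≤
        (D * C ^ (k + 1) / k.factorial) * (u - a) ^ k := by
      intro u hu
      have h1 := le_timeScaleFloor ha.1 hu.1.le
      have h2 := timeScaleFloor_le ha.1 hu.1.le
      have hm : timeScaleFloor 𝕋 u ∈ Icc a b := ⟨h1, h2.trans (hu.2.trans ht.2)⟩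
      calc _ ≤ ‖A (timeScaleFloor 𝕋 u)‖ * ‖peanoBakerTerm 𝕋 A a k (timeScaleFloor 𝕋 u)‖ :=
            norm_mul_le _ _
        _ ≤ C * (D * ((C * (u - a)) ^ k / k.factorial)) := by
            refine mul_le_mul (hC _ ⟨timeScaleFloor_mem h𝕋 ha.1 hu.1.le, hm⟩)
              ((ih _ hm).trans ?_) (norm_nonneg _) hC0
            have : 0 ≤ timeScaleFloor 𝕋 u - a := sub_nonneg.2 h1
            gcongr
        _ = _ := by rw [mul_pow, pow_succ]; ring
    refine (intervalIntegral.norm_integral_le_of_norm_le ht.1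
      (g := fun u => (D * C ^ (k + 1) / k.factorial) * (u - a) ^ k)
      (Eventually.of_forall hle) ?_).trans_eq ?_
    · exact Continuous.intervalIntegrable (by fun_prop) _ _
    · rw [intervalIntegral.integral_const_mul,
        intervalIntegral.integral_comp_sub_right (fun x : ℝ => x ^ k) a, integral_pow, sub_self,
        Nat.factorial_succ, mul_pow, pow_succ (t - a) k]
      have : (k.factorial : ℝ) ≠ 0 := by positivity
      push_cast
      field_simp
      simp only [zero_pow (Nat.succ_ne_zero k), sub_zero]
      ring

/-- The sum of the Peano-Baker series. -/
def peanoBaker (𝕋 : Set ℝ) (A : ℝ → Matrix (Fin n) (Fin n) ℝ) (a t : ℝ) :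
    Matrix (Fin n) (Fin n) ℝ :=
  ∑' k, peanoBakerTerm 𝕋 A a k t

lemma exists_summable_bound_peanoBakerTerm (hA : RdContinuousOn 𝕋 𝕋 A) (h𝕋 : IsClosed 𝕋)
    (ha : IsLeast 𝕋 a) (b : ℝ) : ∃ C : ℝ, 0 ≤ C ∧ (∀ t ∈ 𝕋 ∩ Icc a b, ‖A t‖ ≤ C) ∧
      ∃ c : ℕ → ℝ, Summable c ∧ ∀ k, ∀ t ∈ Icc a b, ‖peanoBakerTerm 𝕋 A a k t‖ ≤ c k := by
  obtain ⟨C, hC0, hC⟩ := hA.exists_bound subset_rfl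
    ((isCompact_Icc (a := a) (b := b)).inter_left h𝕋) inter_subset_left
  refine ⟨C, hC0, hC, fun k => ‖(1 : Matrix (Fin n) (Fin n) ℝ)‖ *
    ((C * (b - a)) ^ k / k.factorial), ?_, fun k t ht => ?_⟩
  · exact (Real.summable_pow_div_factorial _).mul_left _
  · refine (norm_peanoBakerTerm_le hA h𝕋 ha hC hC0 k t ht).trans ?_
    have h1 := sub_nonneg.2 ht.1
    have h2 : t - a ≤ b - a := sub_le_sub_right ht.2 a
    have h3 : (C * (t - a)) ^ k ≤ (C * (b - a)) ^ k := by gcongr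
    exact mul_le_mul_of_nonneg_left (by gcongr) (norm_nonneg _)

lemma continuousOn_peanoBaker (hA : RdContinuousOn 𝕋 𝕋 A) (h𝕋 : IsClosed 𝕋) (ha : IsLeast 𝕋 a) :
    ContinuousOn (peanoBaker 𝕋 A a) (Ici a) := by
  intro t ht
  obtain ⟨C, -, -, c, hc, hb⟩ := exists_summable_bound_peanoBakerTerm hA h𝕋 ha (t + 1)
  have h : ContinuousOn (peanoBaker 𝕋 A a) (Icc a (t + 1)) :=
    continuousOn_tsum (fun k => (peanoBakerTerm_continuousOn hA h𝕋 ha k).mono Icc_subset_Ici_self)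
      hc hb
  refine (h t ⟨ht, by linarith⟩).mono_of_mem_nhdsWithin ?_
  filter_upwards [self_mem_nhdsWithin, nhdsWithin_le_nhds (Iio_mem_nhds (lt_add_one t))] with v hv hv'
  exact ⟨hv, hv'.le⟩

/-- The series may be integrated term by term, with the summable factorial bound as majorant. The
differential equation and the initial value follow from this Volterra equation. -/
lemma peanoBaker_eq (hA : RdContinuousOn 𝕋 𝕋 A) (h𝕋 : IsClosed 𝕋) (ha : IsLeast 𝕋 a) {t : ℝ}
    (ht : a ≤ t) : peanoBaker 𝕋 A a t =
      1 + deltaIntegral 𝕋 (fun τ => A τ * peanoBaker 𝕋 A a τ) a t := by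
  obtain ⟨C, hC0, hC, c, hc, hb⟩ := exists_summable_bound_peanoBakerTerm hA h𝕋 ha t
  have hsum : ∀ u ∈ Icc a t, Summable fun k => peanoBakerTerm 𝕋 A a k u := fun u hu =>
    Summable.of_norm_bounded hc fun k => hb k u hu
  have hfl : ∀ u ∈ uIoc a t, timeScaleFloor 𝕋 u ∈ 𝕋 ∩ Icc a t := fun u hu => by
    rw [uIoc_of_le ht] at hu
    exact ⟨timeScaleFloor_mem h𝕋 ha.1 hu.1.le, le_timeScaleFloor ha.1 hu.1.le,
      (timeScaleFloor_le ha.1 hu.1.le).trans hu.2⟩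
  have key : HasSum (fun k => deltaIntegral 𝕋 (fun τ => A τ * peanoBakerTerm 𝕋 A a k τ) a t)
      (deltaIntegral 𝕋 (fun τ => A τ * peanoBaker 𝕋 A a τ) a t) := by
    refine intervalIntegral.hasSum_integral_of_dominated_convergence (fun k _ => C * c k)
      (fun k => ?_) (fun k => Eventually.of_forall fun u hu => ?_)
      (Eventually.of_forall fun u _ => hc.mul_left C) (by simp)
      (Eventually.of_forall fun u hu => ?_)
    · have h := hA.mul_continuousOn_Ici ha (peanoBakerTerm_continuousOn hA h𝕋 ha k)
      exact (intervalIntegrable_iff.1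
        (h.intervalIntegrable_floor h𝕋 ha le_rfl ht)).aestronglyMeasurable
    · exact (norm_mul_le _ _).trans
        (mul_le_mul (hC _ (hfl u hu)) (hb k _ (hfl u hu).2) (norm_nonneg _) hC0)
    · exact (hsum _ (hfl u hu).2).hasSum.mul_left _
  rw [peanoBaker, (hsum t ⟨ht, le_rfl⟩).tsum_eq_zero_add, ← key.tsum_eq]
  congr 1
  exact tsum_congr fun k => peanoBakerTerm_succ hA h𝕋 ha k ht

lemma hasDeltaDeriv_peanoBaker (hA : RdContinuousOn 𝕋 𝕋 A) (h𝕋 : IsClosed 𝕋) (ha : IsLeast 𝕋 a)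
    {t : ℝ} (ht : t ∈ 𝕋) :
    HasDeltaDeriv 𝕋 (peanoBaker 𝕋 A a) (A t * peanoBaker 𝕋 A a t) t := by
  have h := hA.mul_continuousOn_Ici ha (continuousOn_peanoBaker hA h𝕋 ha)
  have h2 := (hasDeltaDeriv_const (𝕋 := 𝕋) (1 : Matrix (Fin n) (Fin n) ℝ) ht).add
    (hasDeltaDeriv_deltaIntegral h h𝕋 ha ht) ht
  rw [zero_add] at h2
  refine h2.congr_of_eventuallyEq ht ?_ ?_
  · filter_upwards [self_mem_nhdsWithin] with r hr
    exact peanoBaker_eq hA h𝕋 ha (ha.2 hr)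
  · exact peanoBaker_eq hA h𝕋 ha ((ha.2 ht).trans (le_forwardJump 𝕋 t))

lemma peanoBaker_self (hA : RdContinuousOn 𝕋 𝕋 A) (h𝕋 : IsClosed 𝕋) (ha : IsLeast 𝕋 a) :
    peanoBaker 𝕋 A a a = 1 := by
  rw [peanoBaker_eq hA h𝕋 ha le_rfl]
  simp [deltaIntegral]

/-! ## The adjoint system and invertibility -/

/-- The coefficient `-(I + μ A)⁻¹ A` of the equation `Ψ^Δ = Ψ B` solved by the inverse of a
fundamental matrix of `z^Δ = A z`. -/
def adjointCoeff (𝕋 : Set ℝ) (A : ℝ → Matrix (Fin n) (Fin n) ℝ) (t : ℝ) :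
    Matrix (Fin n) (Fin n) ℝ :=
  -((1 + graininess 𝕋 t • A t)⁻¹ * A t)

lemma one_add_graininess_smul_adjointCoeff {t : ℝ} (h : IsUnit (1 + graininess 𝕋 t • A t)) :
    1 + graininess 𝕋 t • adjointCoeff 𝕋 A t = (1 + graininess 𝕋 t • A t)⁻¹ := by
  have h1 : (1 + graininess 𝕋 t • A t)⁻¹ * (1 + graininess 𝕋 t • A t) = 1 :=
    Matrix.nonsing_inv_mul _ ((Matrix.isUnit_iff_isUnit_det _).1 h)
  rw [mul_add, mul_one, Matrix.mul_smul] at h1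
  rw [adjointCoeff, smul_neg, ← sub_eq_add_neg, sub_eq_iff_eq_add, h1]

/-- This is what makes `(Ψ X)^Δ` vanish when `Ψ^Δ = Ψ B` and `X^Δ = A X`: the product rule gives `Ψ
(B + (I + μ B) A) X`. -/
lemma adjointCoeff_add_mul {t : ℝ} (h : IsUnit (1 + graininess 𝕋 t • A t)) :
    adjointCoeff 𝕋 A t + (1 + graininess 𝕋 t • adjointCoeff 𝕋 A t) * A t = 0 := by
  rw [one_add_graininess_smul_adjointCoeff h, adjointCoeff, neg_add_cancel]

lemma rdContinuousOn_graininess {S : Set ℝ} (h𝕋 : IsClosed 𝕋) (hS : S ⊆ 𝕋) :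
    RdContinuousOn 𝕋 S (graininess 𝕋) :=
  (rdContinuousOn_comp_forwardJump h𝕋 hS (f := id) fun _ _ => continuousWithinAt_id).map₂
    (rdContinuousOn_of_continuousWithinAt (f := id) fun _ _ => continuousWithinAt_id)
    (φ := fun x y => x - y) (by fun_prop)

/-- Only continuity of inversion at `I` is needed: the graininess tends to `0` at right-dense points
and from the left at left-dense ones, so `I + μ A → I` there. -/
lemma RdContinuousOn.adjointCoeff {S : Set ℝ} (hA : RdContinuousOn 𝕋 S A) (h𝕋 : IsClosed 𝕋)
    (hS : S ⊆ 𝕋) : RdContinuousOn 𝕋 S (adjointCoeff 𝕋 A) := by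
  intro t ht
  obtain ⟨h1, l, h2⟩ := hA t ht
  have hinv : ContinuousAt (fun N : Matrix (Fin n) (Fin n) ℝ => N⁻¹) 1 :=
    continuousAt_matrix_inv 1 (by
      rw [Matrix.det_one]
      exact NormedRing.inverse_continuousAt (1 : ℝˣ))
  have aux : ∀ {F : Filter ℝ} {L : Matrix (Fin n) (Fin n) ℝ}, Tendsto (graininess 𝕋) F (𝓝 0) →
      Tendsto A F (𝓝 L) → Tendsto (_root_.adjointCoeff 𝕋 A) F (𝓝 (-L)) := by
    intro F L hμ hL
    have h3 : Tendsto (fun r => 1 + graininess 𝕋 r • A r) F (𝓝 1) := by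
      simpa using tendsto_const_nhds.add (hμ.smul hL)
    have h4 := ((hinv.tendsto.comp h3).mul hL).neg
    rwa [inv_one, one_mul] at h4
  refine ⟨fun h => ?_, -l, ?_⟩
  · have hμt : graininess 𝕋 t = 0 := by simp [graininess, h]
    have hμ := ((rdContinuousOn_graininess h𝕋 hS) t ht).1 h
    rw [ContinuousWithinAt, hμt] at hμ
    have := aux hμ (h1 h)
    simpa [ContinuousWithinAt, _root_.adjointCoeff, hμt] using this
  · refine aux ?_ h2
    have h5 := (tendsto_forwardJump_left h𝕋 (hS ht)).mono_right nhdsWithin_le_nhds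
    have h6 : Tendsto (fun r : ℝ => r) (𝓝[𝕋 ∩ Iio t] t) (𝓝 t) := nhdsWithin_le_nhds
    have h7 := h5.sub h6
    rwa [sub_self] at h7

/-- The inverse of the Peano-Baker series, as the transpose of the series of the adjoint system. -/
def peanoBakerInv (𝕋 : Set ℝ) (A : ℝ → Matrix (Fin n) (Fin n) ℝ) (a t : ℝ) :
    Matrix (Fin n) (Fin n) ℝ :=
  (peanoBaker 𝕋 (fun u => (adjointCoeff 𝕋 A u)ᵀ) a t)ᵀ

lemma HasDeltaDeriv.matrix_mul {M N : ℝ → Matrix (Fin n) (Fin n) ℝ}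
    {M' N' : Matrix (Fin n) (Fin n) ℝ} {t : ℝ} (hM : HasDeltaDeriv 𝕋 M M' t)
    (hN : HasDeltaDeriv 𝕋 N N' t) (ht : t ∈ 𝕋) :
    HasDeltaDeriv 𝕋 (fun r => M r * N r) (M' * N t + M (forwardJump 𝕋 t) * N') t :=
  hM.bilinear (ContinuousLinearMap.mul ℝ (Matrix (Fin n) (Fin n) ℝ)) hN ht

lemma HasDeltaDeriv.matrix_mulVec {M : ℝ → Matrix (Fin n) (Fin n) ℝ} {v : ℝ → Fin n → ℝ}
    {M' : Matrix (Fin n) (Fin n) ℝ} {v' : Fin n → ℝ} {t : ℝ} (hM : HasDeltaDeriv 𝕋 M M' t)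
    (hv : HasDeltaDeriv 𝕋 v v' t) (ht : t ∈ 𝕋) :
    HasDeltaDeriv 𝕋 (fun r => M r *ᵥ v r) (M' *ᵥ v t + M (forwardJump 𝕋 t) *ᵥ v') t :=
  hM.bilinear (LinearMap.toContinuousBilinearMap (Matrix.mulVecBilin ℝ ℝ)) hv ht

lemma hasDeltaDeriv_peanoBakerInv (hA : RdContinuousOn 𝕋 𝕋 A) (h𝕋 : IsClosed 𝕋)
    (ha : IsLeast 𝕋 a) {t : ℝ} (ht : t ∈ 𝕋) :
    HasDeltaDeriv 𝕋 (peanoBakerInv 𝕋 A a) (peanoBakerInv 𝕋 A a t * adjointCoeff 𝕋 A t) t := by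
  have hB : RdContinuousOn 𝕋 𝕋 fun u => (adjointCoeff 𝕋 A u)ᵀ :=
    (hA.adjointCoeff h𝕋 subset_rfl).map (Continuous.matrix_transpose continuous_id)
  have h := (hasDeltaDeriv_peanoBaker hB h𝕋 ha ht).clm (LinearMap.toContinuousLinearMap
    (Matrix.transposeLinearEquiv (Fin n) (Fin n) ℝ ℝ).toLinearMap) ht
  have h0 : Matrix.transpose (adjointCoeff 𝕋 A t)ᵀ = adjointCoeff 𝕋 A t := rfl
  have h1 : peanoBakerInv 𝕋 A a t * adjointCoeff 𝕋 A t = ((adjointCoeff 𝕋 A t)ᵀ *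
      peanoBaker 𝕋 (fun u => (adjointCoeff 𝕋 A u)ᵀ) a t)ᵀ := by
    rw [Matrix.transpose_mul, h0, peanoBakerInv]
  rw [h1]
  exact h

/-- The product has zero derivative by the adjoint identity. Taking the series for `X` gives
invertibility; general `X` gives uniqueness. -/
lemma peanoBakerInv_mul_eq (hA : RdContinuousOn 𝕋 𝕋 A) (h𝕋 : IsClosed 𝕋) (ha : IsLeast 𝕋 a)
    (hreg : IsRegressiveOn 𝕋 𝕋 A) {X : ℝ → Matrix (Fin n) (Fin n) ℝ}
    (hX : ∀ t ∈ 𝕋, HasDeltaDeriv 𝕋 X (A t * X t) t) {t : ℝ} (ht : t ∈ 𝕋) :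
    peanoBakerInv 𝕋 A a t * X t = X a := by
  have hB : RdContinuousOn 𝕋 𝕋 fun u => (adjointCoeff 𝕋 A u)ᵀ :=
    (hA.adjointCoeff h𝕋 subset_rfl).map (Continuous.matrix_transpose continuous_id)
  have h := eq_of_hasDeltaDeriv_zero h𝕋 ha
    (f := fun r => peanoBakerInv 𝕋 A a r * X r) (fun r hr => ?_) ht
  · simpa [peanoBakerInv, peanoBaker_self hB h𝕋 ha] using h
  · have hΨ := hasDeltaDeriv_peanoBakerInv hA h𝕋 ha hr
    convert hΨ.matrix_mul (hX r hr) hr using 1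
    have h0 := congrArg (fun M => peanoBakerInv 𝕋 A a r * M * X r)
      (adjointCoeff_add_mul (hreg r hr))
    rw [hΨ.apply_forwardJump hr]
    simp only [mul_zero, zero_mul] at h0
    rw [← h0]
    simp only [mul_add, add_mul, one_mul, Matrix.mul_smul, Matrix.smul_mul, mul_assoc]

lemma peanoBakerInv_mul_self (hA : RdContinuousOn 𝕋 𝕋 A) (h𝕋 : IsClosed 𝕋) (ha : IsLeast 𝕋 a)
    (hreg : IsRegressiveOn 𝕋 𝕋 A) {t : ℝ} (ht : t ∈ 𝕋) :
    peanoBakerInv 𝕋 A a t * peanoBaker 𝕋 A a t = 1 :=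
  (peanoBakerInv_mul_eq hA h𝕋 ha hreg (fun _ hr => hasDeltaDeriv_peanoBaker hA h𝕋 ha hr) ht).trans
    (peanoBaker_self hA h𝕋 ha)

/-- Uniqueness for matrix solutions of a linear system. -/
lemma eq_peanoBaker_mul (hA : RdContinuousOn 𝕋 𝕋 A) (h𝕋 : IsClosed 𝕋) (ha : IsLeast 𝕋 a)
    (hreg : IsRegressiveOn 𝕋 𝕋 A) {X : ℝ → Matrix (Fin n) (Fin n) ℝ}
    (hX : ∀ t ∈ 𝕋, HasDeltaDeriv 𝕋 X (A t * X t) t) {t : ℝ} (ht : t ∈ 𝕋) :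
    X t = peanoBaker 𝕋 A a t * X a := by
  rw [← peanoBakerInv_mul_eq hA h𝕋 ha hreg hX ht, ← mul_assoc,
    mul_eq_one_comm.1 (peanoBakerInv_mul_self hA h𝕋 ha hreg ht), one_mul]

end peanoBaker

/-! ## Final segments of a time scale -/

/-- `S` is an upward closed part without minimum of the closed set `𝕋`. -/
structure IsOpenFinalSegment (𝕋 S : Set ℝ) : Prop where
  isClosed : IsClosed 𝕋
  subset : S ⊆ 𝕋
  inter_Ici_subset : ∀ a ∈ S, 𝕋 ∩ Ici a ⊆ S
  exists_lt : ∀ t ∈ S, ∃ a ∈ S, a < t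

lemma isLeast_inter_Ici {𝕋 : Set ℝ} {a : ℝ} (ha : a ∈ 𝕋) : IsLeast (𝕋 ∩ Ici a) a :=
  ⟨⟨ha, self_mem_Ici⟩, fun _ hr => hr.2⟩

namespace IsOpenFinalSegment

section calculus

variable {E : Type*} [NormedAddCommGroup E] [NormedSpace ℝ E] {𝕋 S : Set ℝ} {f : ℝ → E}
  {t t₀ : ℝ}

lemma forwardJump_mem (hS : IsOpenFinalSegment 𝕋 S) (ht : t ∈ S) : forwardJump 𝕋 t ∈ S :=
  hS.inter_Ici_subset t ht ⟨_root_.forwardJump_mem hS.isClosed (hS.subset ht),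
    le_forwardJump 𝕋 t⟩

lemma isClosed_inter_Ici (hS : IsOpenFinalSegment 𝕋 S) (a : ℝ) : IsClosed (𝕋 ∩ Ici a) :=
  hS.isClosed.inter isClosed_Ici

/-- Having no minimum, `S` contains all of `𝕋` near each of its points, so limits along `S` and
along `𝕋` agree. -/
lemma nhdsWithin_eq (hS : IsOpenFinalSegment 𝕋 S) (ht : t ∈ S) : 𝓝[S] t = 𝓝[𝕋] t := by
  obtain ⟨a, ha, hat⟩ := hS.exists_lt t ht
  refine le_antisymm (nhdsWithin_mono _ hS.subset) ?_
  rw [← nhdsWithin_inter_Ici_of_lt hat]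
  exact nhdsWithin_mono _ (hS.inter_Ici_subset a ha)

/-- Supplies the base point `a` of the truncation `𝕋 ∩ [a, ∞)`, which has a least element; lying
strictly below both points, `a` leaves the derivatives there unchanged. -/
lemma exists_lt_both (hS : IsOpenFinalSegment 𝕋 S) {c d : ℝ} (hc : c ∈ S) (hd : d ∈ S) :
    ∃ a ∈ S, a < c ∧ a < d := by
  have hm : min c d ∈ S := by rcases min_choice c d with e | e <;> rw [e] <;> assumption
  obtain ⟨a, ha, had⟩ := hS.exists_lt _ hm
  exact ⟨a, ha, lt_min_iff.1 had⟩

lemma intervalIntegrable_floor {X : Type*} [NormedAddCommGroup X] {f : ℝ → X}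
    (hS : IsOpenFinalSegment 𝕋 S) (hf : RdContinuousOn 𝕋 S f)
    {c d : ℝ} (hc : c ∈ S) (hd : d ∈ S) :
    IntervalIntegrable (fun u => f (timeScaleFloor 𝕋 u)) MeasureTheory.volume c d := by
  obtain ⟨a, ha, hac, had⟩ := hS.exists_lt_both hc hd
  have h := (hf.inter_Ici (hS.inter_Ici_subset a ha)).intervalIntegrable_floor
    (hS.isClosed_inter_Ici a) (isLeast_inter_Ici (hS.subset ha)) hac.le had.le
  refine h.congr fun u hu => ?_
  simp only [timeScaleFloor_inter_Ici (hS.subset ha) ((lt_min hac had).le.trans hu.1.le)]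

lemma eq_of_hasDeltaDeriv_zero (hS : IsOpenFinalSegment 𝕋 S)
    (hf : ∀ t ∈ S, HasDeltaDeriv 𝕋 f 0 t) {c d : ℝ} (hc : c ∈ S) (hd : d ∈ S) : f c = f d := by
  obtain ⟨a, ha, hac, had⟩ := hS.exists_lt_both hc hd
  have h : ∀ t ∈ 𝕋 ∩ Ici a, HasDeltaDeriv (𝕋 ∩ Ici a) f 0 t := fun t ht =>
    (hf t (hS.inter_Ici_subset a ha ht)).inter_Ici ht.1 ht.2
  have h2 := fun {e : ℝ} (he : e ∈ 𝕋 ∩ Ici a) => _root_.eq_of_hasDeltaDeriv_zero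
    (hS.isClosed_inter_Ici a) (isLeast_inter_Ici (hS.subset ha)) h he
  exact (h2 ⟨hS.subset hc, hac.le⟩).trans (h2 ⟨hS.subset hd, had.le⟩).symm

lemma deltaIntegral_sub (hS : IsOpenFinalSegment 𝕋 S) (hf : RdContinuousOn 𝕋 S f)
    {c d e : ℝ} (hc : c ∈ S) (hd : d ∈ S) (he : e ∈ S) :
    deltaIntegral 𝕋 f c e - deltaIntegral 𝕋 f c d = deltaIntegral 𝕋 f d e :=
  intervalIntegral.integral_interval_sub_left (hS.intervalIntegrable_floor hf hc he)
    (hS.intervalIntegrable_floor hf hc hd)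

lemma hasDeltaDeriv_deltaIntegral [CompleteSpace E] (hS : IsOpenFinalSegment 𝕋 S)
    (hf : RdContinuousOn 𝕋 S f) (ht₀ : t₀ ∈ S) (ht : t ∈ S) :
    HasDeltaDeriv 𝕋 (deltaIntegral 𝕋 f t₀) (f t) t := by
  obtain ⟨a, ha, hat, hat₀⟩ := hS.exists_lt_both ht ht₀
  have ha𝕋 := hS.subset ha
  have ht𝕋 := hS.subset ht
  have h := (_root_.hasDeltaDeriv_deltaIntegral (hf.inter_Ici (hS.inter_Ici_subset a ha))
    (hS.isClosed_inter_Ici a) (isLeast_inter_Ici ha𝕋) ⟨ht𝕋, hat.le⟩).of_inter_Ici ht𝕋 hat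
  have h2 := h.sub (hasDeltaDeriv_const (deltaIntegral 𝕋 f a t₀) ht𝕋) ht𝕋
  rw [sub_zero] at h2
  have hval : ∀ r ∈ 𝕋, a ≤ r → deltaIntegral 𝕋 f t₀ r =
      deltaIntegral (𝕋 ∩ Ici a) f a r - deltaIntegral 𝕋 f a t₀ := fun r hr har => by
    rw [deltaIntegral_inter_Ici ha𝕋 har,
      hS.deltaIntegral_sub hf ha ht₀ (hS.inter_Ici_subset a ha ⟨hr, har⟩)]
  refine h2.congr_of_eventuallyEq ht𝕋 ?_ ?_
  · filter_upwards [self_mem_nhdsWithin, nhdsWithin_le_nhds (Ioi_mem_nhds hat)] with r hr har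
    exact hval r hr har.le
  · exact hval _ (_root_.forwardJump_mem hS.isClosed ht𝕋) (hat.le.trans (le_forwardJump 𝕋 t))

end calculus

/-! ## The transition matrix -/

section transition

open scoped Matrix.Norms.Operator

variable {n : ℕ} {𝕋 S : Set ℝ} {A : ℝ → Matrix (Fin n) (Fin n) ℝ} {t t₀ : ℝ}

lemma peanoBakerTerm_inter_Ici (h𝕋 : IsClosed 𝕋) {a : ℝ} (ha : a ∈ 𝕋) (k : ℕ) {t : ℝ}
    (hat : a ≤ t) : peanoBakerTerm (𝕋 ∩ Ici a) A a k t = peanoBakerTerm 𝕋 A a k t := by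
  induction k generalizing t with
  | zero => rfl
  | succ k ih =>
    ext i j
    simp only [peanoBakerTerm, Matrix.of_apply]
    rw [deltaIntegral_inter_Ici ha hat]
    exact deltaIntegral_congr h𝕋 ha hat fun r _ har _ => by rw [ih har]

lemma peanoBaker_inter_Ici (h𝕋 : IsClosed 𝕋) {a : ℝ} (ha : a ∈ 𝕋) {t : ℝ} (hat : a ≤ t) :
    peanoBaker (𝕋 ∩ Ici a) A a t = peanoBaker 𝕋 A a t :=
  tsum_congr fun k => peanoBakerTerm_inter_Ici h𝕋 ha k hat

lemma isRegressiveOn_inter_Ici (hS : IsOpenFinalSegment 𝕋 S)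
    (hreg : IsRegressiveOn 𝕋 S A) {a : ℝ} (ha : a ∈ S) :
    IsRegressiveOn (𝕋 ∩ Ici a) (𝕋 ∩ Ici a) A := fun t ht => by
  have := hreg t (hS.inter_Ici_subset a ha ht)
  rwa [graininess, ← forwardJump_inter_Ici ht.2] at this

variable (hS : IsOpenFinalSegment 𝕋 S) (hA : RdContinuousOn 𝕋 S A) (hreg : IsRegressiveOn 𝕋 S A)
include hS hA hreg

/-- Uniqueness on `𝕋 ∩ [b, ∞)`: the series started at `a` also solves the system there. -/
lemma peanoBaker_mul_peanoBaker {a b c : ℝ} (ha : a ∈ S) (hb : b ∈ S) (hc : c ∈ S) (hab : a ≤ b)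
    (hbc : b ≤ c) : peanoBaker (𝕋 ∩ Ici a) A a c =
      peanoBaker 𝕋 A b c * peanoBaker (𝕋 ∩ Ici a) A a b := by
  have hb𝕋 := hS.subset hb
  rw [← peanoBaker_inter_Ici hS.isClosed hb𝕋 hbc]
  refine eq_peanoBaker_mul (hA.inter_Ici (hS.inter_Ici_subset b hb)) (hS.isClosed_inter_Ici b)
    (isLeast_inter_Ici hb𝕋) (hS.isRegressiveOn_inter_Ici hreg hb) (fun r hr => ?_)
    ⟨hS.subset hc, hbc⟩
  exact (hasDeltaDeriv_peanoBaker (hA.inter_Ici (hS.inter_Ici_subset a ha))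
    (hS.isClosed_inter_Ici a) (isLeast_inter_Ici (hS.subset ha))
    ⟨hr.1, hab.trans hr.2⟩).mono_Ici hab hr.1 hr.2

lemma peanoBakerInv_mul_self {a : ℝ} (ha : a ∈ S) (ht : t ∈ S) (hat : a ≤ t) :
    peanoBakerInv (𝕋 ∩ Ici a) A a t * peanoBaker (𝕋 ∩ Ici a) A a t = 1 :=
  _root_.peanoBakerInv_mul_self (hA.inter_Ici (hS.inter_Ici_subset a ha)) (hS.isClosed_inter_Ici a)
    (isLeast_inter_Ici (hS.subset ha)) (hS.isRegressiveOn_inter_Ici hreg ha) ⟨hS.subset ht, hat⟩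

/-- Both branches of the definition become `X(t) X(t₀)⁻¹`, with `X` the series started at a common
earlier point, so differentiation across `t₀` needs no case split. -/
lemma transitionMatrix_eq {a : ℝ} (ha : a ∈ S) (ht : t ∈ S) (ht₀ : t₀ ∈ S) (hat : a ≤ t)
    (hat₀ : a ≤ t₀) : transitionMatrix 𝕋 A t t₀ =
      peanoBaker (𝕋 ∩ Ici a) A a t * peanoBakerInv (𝕋 ∩ Ici a) A a t₀ := by
  have h1 := mul_eq_one_comm.1 (hS.peanoBakerInv_mul_self hA hreg ha ht₀ hat₀)
  rcases le_or_gt t₀ t with h | h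
  · rw [transitionMatrix, if_pos h]
    change peanoBaker 𝕋 A t₀ t = _
    rw [hS.peanoBaker_mul_peanoBaker hA hreg ha ht₀ ht hat₀ h, mul_assoc, h1, mul_one]
  · rw [transitionMatrix, if_neg (not_le.2 h)]
    change (peanoBaker 𝕋 A t t₀)⁻¹ = _
    refine Matrix.inv_eq_right_inv ?_
    rw [hS.peanoBaker_mul_peanoBaker hA hreg ha ht ht₀ hat h.le, mul_assoc] at h1
    rwa [← mul_assoc] at h1 ⊢

lemma transitionMatrix_inv_eq {a : ℝ} (ha : a ∈ S) (ht : t ∈ S) (ht₀ : t₀ ∈ S) (hat : a ≤ t)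
    (hat₀ : a ≤ t₀) : (transitionMatrix 𝕋 A t t₀)⁻¹ =
      peanoBaker (𝕋 ∩ Ici a) A a t₀ * peanoBakerInv (𝕋 ∩ Ici a) A a t := by
  have h1 := hS.peanoBakerInv_mul_self hA hreg ha ht₀ hat₀
  have h2 := mul_eq_one_comm.1 (hS.peanoBakerInv_mul_self hA hreg ha ht hat)
  refine Matrix.inv_eq_right_inv ?_
  rw [hS.transitionMatrix_eq hA hreg ha ht ht₀ hat hat₀, mul_assoc,
    ← mul_assoc (peanoBakerInv (𝕋 ∩ Ici a) A a t₀), h1, one_mul, h2]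

lemma isUnit_transitionMatrix (ht : t ∈ S) (ht₀ : t₀ ∈ S) : IsUnit (transitionMatrix 𝕋 A t t₀) := by
  obtain ⟨a, ha, hat, hat₀⟩ := hS.exists_lt_both ht ht₀
  rw [hS.transitionMatrix_eq hA hreg ha ht ht₀ hat.le hat₀.le]
  have h1 := hS.peanoBakerInv_mul_self hA hreg ha ht₀ hat₀.le
  have h2 := hS.peanoBakerInv_mul_self hA hreg ha ht hat.le
  exact (IsUnit.of_mul_eq_one_right _ h2).mul (IsUnit.of_mul_eq_one _ h1)

lemma transitionMatrix_self (ht₀ : t₀ ∈ S) : transitionMatrix 𝕋 A t₀ t₀ = 1 := by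
  rw [hS.transitionMatrix_eq hA hreg ht₀ ht₀ ht₀ le_rfl le_rfl]
  exact mul_eq_one_comm.1 (hS.peanoBakerInv_mul_self hA hreg ht₀ ht₀ le_rfl)

lemma hasDeltaDeriv_transitionMatrix (ht₀ : t₀ ∈ S) (ht : t ∈ S) :
    HasDeltaDeriv 𝕋 (fun r => transitionMatrix 𝕋 A r t₀) (A t * transitionMatrix 𝕋 A t t₀) t := by
  obtain ⟨a, ha, hat, hat₀⟩ := hS.exists_lt_both ht ht₀
  have ht𝕋 := hS.subset ht
  have h := (hasDeltaDeriv_peanoBaker (hA.inter_Ici (hS.inter_Ici_subset a ha))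
    (hS.isClosed_inter_Ici a) (isLeast_inter_Ici (hS.subset ha)) ⟨ht𝕋, hat.le⟩).of_inter_Ici ht𝕋 hat
  have h2 := h.matrix_mul (hasDeltaDeriv_const (peanoBakerInv (𝕋 ∩ Ici a) A a t₀) ht𝕋) ht𝕋
  rw [mul_zero, add_zero, mul_assoc, ← hS.transitionMatrix_eq hA hreg ha ht ht₀ hat.le hat₀.le] at h2
  have hval : ∀ r ∈ 𝕋, a ≤ r → transitionMatrix 𝕋 A r t₀ = _ := fun r hr har =>
    hS.transitionMatrix_eq hA hreg ha (hS.inter_Ici_subset a ha ⟨hr, har⟩) ht₀ har hat₀.le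
  refine h2.congr_of_eventuallyEq ht𝕋 ?_ ?_
  · filter_upwards [self_mem_nhdsWithin, nhdsWithin_le_nhds (Ioi_mem_nhds hat)] with r hr har
    exact hval r hr har.le
  · exact hval _ (_root_.forwardJump_mem hS.isClosed ht𝕋) (hat.le.trans (le_forwardJump 𝕋 t))

lemma hasDeltaDeriv_transitionMatrix_inv (ht₀ : t₀ ∈ S) (ht : t ∈ S) :
    HasDeltaDeriv 𝕋 (fun r => (transitionMatrix 𝕋 A r t₀)⁻¹)
      ((transitionMatrix 𝕋 A t t₀)⁻¹ * adjointCoeff 𝕋 A t) t := by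
  obtain ⟨a, ha, hat, hat₀⟩ := hS.exists_lt_both ht ht₀
  have ht𝕋 := hS.subset ht
  have h := (hasDeltaDeriv_peanoBakerInv (hA.inter_Ici (hS.inter_Ici_subset a ha))
    (hS.isClosed_inter_Ici a) (isLeast_inter_Ici (hS.subset ha)) ⟨ht𝕋, hat.le⟩).of_inter_Ici ht𝕋 hat
  have h2 := (hasDeltaDeriv_const (peanoBaker (𝕋 ∩ Ici a) A a t₀) ht𝕋).matrix_mul h ht𝕋
  have hadj : adjointCoeff (𝕋 ∩ Ici a) A t = adjointCoeff 𝕋 A t := by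
    simp only [adjointCoeff, graininess, forwardJump_inter_Ici hat.le]
  rw [zero_mul, zero_add, ← mul_assoc, hadj,
    ← hS.transitionMatrix_inv_eq hA hreg ha ht ht₀ hat.le hat₀.le] at h2
  have hval : ∀ r ∈ 𝕋, a ≤ r → (transitionMatrix 𝕋 A r t₀)⁻¹ = _ := fun r hr har =>
    hS.transitionMatrix_inv_eq hA hreg ha (hS.inter_Ici_subset a ha ⟨hr, har⟩) ht₀ har hat₀.le
  refine h2.congr_of_eventuallyEq ht𝕋 ?_ ?_
  · filter_upwards [self_mem_nhdsWithin, nhdsWithin_le_nhds (Ioi_mem_nhds hat)] with r hr har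
    exact hval r hr har.le
  · exact hval _ (_root_.forwardJump_mem hS.isClosed ht𝕋) (hat.le.trans (le_forwardJump 𝕋 t))

end transition

end IsOpenFinalSegment

/-! ## Order properties of shift operators -/

/-- A strictly monotone bijection of an upward closed part of a closed set is continuous. -/
lemma IsOpenFinalSegment.continuousOn_of_strictMonoOn {𝕋 S : Set ℝ} (hS : IsOpenFinalSegment 𝕋 S)
    {f : ℝ → ℝ} (hf : StrictMonoOn f S) (hmaps : ∀ t ∈ S, f t ∈ S)
    (hsurj : ∀ v ∈ S, ∃ w ∈ S, f w = v) : ContinuousOn f S := by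
  intro t ht
  refine tendsto_order.2 ⟨fun c hc => ?_, fun c hc => ?_⟩
  · obtain ⟨b, hb, hbt⟩ := hS.exists_lt t ht
    have hne : (f '' (S ∩ Iio t)).Nonempty := ⟨f b, b, ⟨hb, hbt⟩, rfl⟩
    by_cases h : ∃ r ∈ S, r < t ∧ c < f r
    · obtain ⟨r, hr, hrt, hcr⟩ := h
      filter_upwards [self_mem_nhdsWithin, nhdsWithin_le_nhds (Ioi_mem_nhds hrt)] with u hu hru
      exact hcr.trans (hf hr hu hru)
    -- Otherwise the supremum of the values left of `t` is itself a value `f w` with `w < t`. Then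
    -- `S` has no point strictly between `w` and `t`, and every `u > w` in `S` satisfies `u ≥ t`.
    · push Not at h
      have hub : ∀ v ∈ f '' (S ∩ Iio t), v ≤ c := by
        rintro _ ⟨r, hr, rfl⟩
        exact h r hr.1 hr.2
      have hbdd : BddAbove (f '' (S ∩ Iio t)) := ⟨c, hub⟩
      have hL𝕋 : sSup (f '' (S ∩ Iio t)) ∈ 𝕋 := by
        refine hS.isClosed.closure_subset_iff.2 ?_ (csSup_mem_closure hne hbdd)
        rintro _ ⟨r, hr, rfl⟩
        exact hS.subset (hmaps r hr.1)
      have hLS := hS.inter_Ici_subset _ (hmaps b hb) ⟨hL𝕋, le_csSup hbdd ⟨b, ⟨hb, hbt⟩, rfl⟩⟩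
      obtain ⟨w, hw, hwL⟩ := hsurj _ hLS
      have hwt : w < t := by
        rw [← hf.lt_iff_lt hw ht, hwL]
        exact (csSup_le hne hub).trans_lt hc
      filter_upwards [self_mem_nhdsWithin, nhdsWithin_le_nhds (Ioi_mem_nhds hwt)] with u hu hwu
      refine hc.trans_le (hf.monotoneOn ht hu ?_)
      by_contra! hut
      have h1 := le_csSup hbdd ⟨u, ⟨hu, hut⟩, rfl⟩
      rw [← hwL] at h1
      exact absurd (hf hw hu hwu) (not_lt.2 h1)
  · by_cases hne : (f '' (S ∩ Ioi t)).Nonempty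
    · by_cases h : ∃ r ∈ S, t < r ∧ f r < c
      · obtain ⟨r, hr, hrt, hcr⟩ := h
        filter_upwards [self_mem_nhdsWithin, nhdsWithin_le_nhds (Iio_mem_nhds hrt)] with u hu hru
        exact (hf hu hr hru).trans hcr
      · push Not at h
        have hlb : ∀ v ∈ f '' (S ∩ Ioi t), c ≤ v := by
          rintro _ ⟨r, hr, rfl⟩
          exact h r hr.1 hr.2
        have hbdd : BddBelow (f '' (S ∩ Ioi t)) := ⟨c, hlb⟩
        have hL𝕋 : sInf (f '' (S ∩ Ioi t)) ∈ 𝕋 := by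
          refine hS.isClosed.closure_subset_iff.2 ?_ (csInf_mem_closure hne hbdd)
          rintro _ ⟨r, hr, rfl⟩
          exact hS.subset (hmaps r hr.1)
        have hcL := le_csInf hne hlb
        have hLS := hS.inter_Ici_subset _ (hmaps t ht) ⟨hL𝕋, hc.le.trans hcL⟩
        obtain ⟨w, hw, hwL⟩ := hsurj _ hLS
        have hwt : t < w := by
          rw [← hf.lt_iff_lt ht hw, hwL]
          exact hc.trans_le hcL
        filter_upwards [self_mem_nhdsWithin, nhdsWithin_le_nhds (Iio_mem_nhds hwt)] with u hu hwu
        refine (hf.monotoneOn hu ht ?_).trans_lt hc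
        by_contra! hut
        have h1 := csInf_le hbdd ⟨u, ⟨hu, hut⟩, rfl⟩
        rw [← hwL] at h1
        exact absurd (hf hu hw hwu) (not_lt.2 h1)
    · filter_upwards [self_mem_nhdsWithin] with u hu
      refine (hf.monotoneOn hu ht ?_).trans_lt hc
      by_contra! hut
      exact hne ⟨f u, u, ⟨hu, hut⟩, rfl⟩

/-- An order isomorphism carries the next point to the next point: `r > f t` gives `g r > t`, so
`σ(t) ≤ g r`. The hypothesis `hlt` excludes the convention for `σ` at a maximum. -/
lemma IsOpenFinalSegment.apply_forwardJump_le {𝕋 S : Set ℝ} (hS : IsOpenFinalSegment 𝕋 S)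
    {f g : ℝ → ℝ} (hf : StrictMonoOn f S) (hg : StrictMonoOn g S) (hfS : ∀ t ∈ S, f t ∈ S)
    (hgS : ∀ t ∈ S, g t ∈ S) (hfg : ∀ t ∈ S, f (g t) = t) (hgf : ∀ t ∈ S, g (f t) = t)
    (hlt : ∀ t ∈ S, ∃ u ∈ S, t < u) {t : ℝ} (ht : t ∈ S) :
    f (forwardJump 𝕋 t) ≤ forwardJump 𝕋 (f t) := by
  obtain ⟨u, hu, htu⟩ := hlt _ (hfS t ht)
  have hne : (𝕋 ∩ Ioi (f t)).Nonempty := ⟨u, hS.subset hu, htu⟩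
  rw [forwardJump.eq_def 𝕋 (f t), if_pos hne]
  refine le_csInf hne fun r hr => ?_
  have hrS := hS.inter_Ici_subset _ (hfS t ht) ⟨hr.1, mem_Ici.2 (le_of_lt hr.2)⟩
  have h1 : t < g r := by
    have := hg (hfS t ht) hrS hr.2
    rwa [hgf t ht] at this
  have h2 := hf.monotoneOn (hS.forwardJump_mem ht) (hgS r hrS)
    (forwardJump_le (hS.subset (hgS r hrS)) h1)
  rwa [hfg r hrS] at h2

lemma IsPeriodicInShifts.shift_mem {𝕋 S : Set ℝ} {t₀ T : ℝ} {δp δm : ℝ → ℝ → ℝ}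
    (hT : IsPeriodicInShifts 𝕋 S t₀ δp δm T) {t : ℝ} (ht : t ∈ S) : δp T t ∈ S := (hT.2.2 t ht).1.2.2.2

lemma IsPeriodicInShifts.shift_m_mem {𝕋 S : Set ℝ} {t₀ T : ℝ} {δp δm : ℝ → ℝ → ℝ}
    (hT : IsPeriodicInShifts 𝕋 S t₀ δp δm T) {t : ℝ} (ht : t ∈ S) : δm T t ∈ S := (hT.2.2 t ht).2.2.2.2

lemma IsPeriodicInShifts.shift_iterate_mem {𝕋 S : Set ℝ} {t₀ T : ℝ} {δp δm : ℝ → ℝ → ℝ}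
    (hT : IsPeriodicInShifts 𝕋 S t₀ δp δm T) {t : ℝ} (ht : t ∈ S) (k : ℕ) : (δp T)^[k] t ∈ S := by
  induction k with
  | zero => exact ht
  | succ k ih => rw [Function.iterate_succ_apply']; exact hT.shift_mem ih

namespace IsShiftPair

variable {𝕋 S : Set ℝ} {t₀ T : ℝ} {δp δm : ℝ → ℝ → ℝ}

section basic

variable (h : IsShiftPair 𝕋 S t₀ δp δm) (hT : IsPeriodicInShifts 𝕋 S t₀ δp δm T)
include h

lemma mem_of_le {t : ℝ} (ht : t ∈ 𝕋) (ht₀ : t₀ ≤ t) : t ∈ S := by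
  obtain ⟨h1, h2⟩ := h.apply_initial t ht ht₀
  exact h2 ▸ h1.2.2.2

lemma initial_m {t : ℝ} (ht : t ∈ S) : (t₀, t) ∈ shiftDomain 𝕋 S t₀ δm ∧ δm t₀ t = t := by
  obtain ⟨h1, h2⟩ := h.initial_apply t ht
  have := h.inv_p _ _ h1
  rwa [h2] at this

include hT

lemma m_shift {t : ℝ} (ht : t ∈ S) : δm T (δp T t) = t := (h.inv_p _ _ (hT.2.2 t ht).1).2

lemma shift_m {t : ℝ} (ht : t ∈ S) : δp T (δm T t) = t := (h.inv_m _ _ (hT.2.2 t ht).2).2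

lemma lt_shift {t : ℝ} (ht : t ∈ S) : t < δp T t := by
  obtain ⟨h1, h2⟩ := h.initial_apply t ht
  have := h.first_p _ _ _ h1 (hT.2.2 t ht).1 hT.2.1
  rwa [h2] at this

lemma shift_m_lt {t : ℝ} (ht : t ∈ S) : δm T t < t := by
  obtain ⟨h1, h2⟩ := h.initial_m ht
  have := h.first_m _ _ _ h1 (hT.2.2 t ht).2 hT.2.1
  rwa [h2] at this

lemma isOpenFinalSegment (h𝕋 : IsClosed 𝕋) (hconv : ∀ t ∈ S, Set.uIcc t₀ t ∩ 𝕋 ⊆ S) :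
    IsOpenFinalSegment 𝕋 S where
  isClosed := h𝕋
  subset := h.subset
  inter_Ici_subset := by
    rintro a ha u ⟨hu, hau⟩
    rcases le_total t₀ u with h0 | h0
    · exact h.mem_of_le hu h0
    · exact hconv a ha ⟨mem_uIcc.2 (Or.inr ⟨hau, h0⟩), hu⟩
  exists_lt := fun t ht => ⟨δm T t, hT.shift_m_mem ht, h.shift_m_lt hT ht⟩

lemma strictMono_shift_iterate {t : ℝ} (ht : t ∈ S) : StrictMono fun k => (δp T)^[k] t :=
  strictMono_nat_of_lt_succ fun k => by
    rw [Function.iterate_succ_apply']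
    exact h.lt_shift hT (hT.shift_iterate_mem ht k)

/-- Iterating the shift by a continuous `δ₊^T`, one passes every point. -/
lemma exists_le_shift_iterate (hS : IsOpenFinalSegment 𝕋 S)
    (hcont : ∀ t ∈ S, ContinuousWithinAt (δp T) 𝕋 t) {t : ℝ} (ht : t ∈ S) (c : ℝ) :
    ∃ k, ∀ j, k ≤ j → c ≤ (δp T)^[j] t := by
  have hmono := h.strictMono_shift_iterate hT ht
  by_contra! hlt
  have hub : ∀ k, (δp T)^[k] t ≤ c := fun k => by
    obtain ⟨j, hj, hjc⟩ := hlt k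
    exact (hmono.monotone hj).trans hjc.le
  have hbdd : BddAbove (range fun k => (δp T)^[k] t) := ⟨c, by rintro _ ⟨k, rfl⟩; exact hub k⟩
  have htend := tendsto_atTop_ciSup hmono.monotone hbdd
  set L := ⨆ k, (δp T)^[k] t
  -- A bounded orbit would converge to a point of `S` fixed by the continuous shift, against
  -- `lt_shift`.
  have hL𝕋 : L ∈ 𝕋 := hS.isClosed.mem_of_tendsto htend
    (Eventually.of_forall fun k => hS.subset (hT.shift_iterate_mem ht k))
  have hLS : L ∈ S := hS.inter_Ici_subset t ht ⟨hL𝕋, le_ciSup hbdd 0⟩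
  have h1 : Tendsto (fun k => δp T ((δp T)^[k] t)) atTop (𝓝 (δp T L)) :=
    (hcont L hLS).tendsto.comp (tendsto_nhdsWithin_iff.2 ⟨htend,
      Eventually.of_forall fun k => hS.subset (hT.shift_iterate_mem ht k)⟩)
  have h2 : Tendsto (fun k => δp T ((δp T)^[k] t)) atTop (𝓝 L) := by
    have := (tendsto_add_atTop_iff_nat 1).2 htend
    simpa only [Function.iterate_succ_apply'] using this
  exact absurd (tendsto_nhds_unique h1 h2) (h.lt_shift hT hLS).ne'

end basic

/-! ### Monotonicity, surjectivity and continuity of the delay `δ₋(c, ·)`. -/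

section delay

variable (h : IsShiftPair 𝕋 S t₀ δp δm) (hT : IsPeriodicInShifts 𝕋 S t₀ δp δm T)
  (hS : IsOpenFinalSegment 𝕋 S) (hcont : ∀ t ∈ S, ContinuousWithinAt (δp T) 𝕋 t)
  {c : ℝ} (hc : ∀ t ∈ S, (c, t) ∈ shiftDomain 𝕋 S t₀ δm)
include h hT hc

lemma delay_shift {t : ℝ} (ht : t ∈ S) : δm c (δp T t) = δp T (δm c t) :=
  (h.comm_p T t c (hT.2.2 t ht).1 (hc _ (hT.shift_mem ht))).2

lemma delay_shift_m {t : ℝ} (ht : t ∈ S) : δm c (δm T t) = δm T (δm c t) := by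
  have h1 := h.delay_shift hT hc (hT.shift_m_mem ht)
  rw [h.shift_m hT ht] at h1
  rw [h1, h.m_shift hT (hc _ (hT.shift_m_mem ht)).2.2.2]

/-- The delay operator in terms of a forward shift of one fixed point. -/
lemma delay_eq {t : ℝ} (ht : t ∈ S) (k : ℕ) (hk : t₀ ≤ (δp T)^[k] t) :
    ((δp T)^[k] t, (δm T)^[k] (δm c t₀)) ∈ shiftDomain 𝕋 S t₀ δp ∧
      δm c t = δp ((δp T)^[k] t) ((δm T)^[k] (δm c t₀)) := by
  have hrS := hT.shift_iterate_mem ht k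
  have hr𝕋 := h.subset hrS
  have hit : ∀ j, ((δp T)^[k] t, (δm T)^[j] (δm c t₀)) ∈ shiftDomain 𝕋 S t₀ δp ∧
      (δm T)^[j] (δm c ((δp T)^[k] t)) = δp ((δp T)^[k] t) ((δm T)^[j] (δm c t₀)) := by
    intro j
    induction j with
    | zero =>
      obtain ⟨h1, h2⟩ := h.apply_initial _ hr𝕋 hk
      -- A point `r ≥ t₀` equals `δ₊(r, t₀)`, so the commutation axiom moves `δ₋(c, ·)` onto `t₀`.
      have h3 := h.comm_p _ t₀ c h1 (h2.symm ▸ hc _ hrS)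
      rw [h2] at h3
      exact h3
    | succ j ih =>
      have h3 := h.comm_p _ _ T ih.1 (hT.2.2 _ ih.1.2.2.2).2
      rw [Function.iterate_succ_apply', Function.iterate_succ_apply', ih.2]
      exact h3
  refine ⟨(hit k).1, ?_⟩
  rw [← (hit k).2]
  clear hit hk hrS hr𝕋
  induction k generalizing t with
  | zero => rfl
  | succ k ih =>
    rw [Function.iterate_succ_apply' (δm T), Function.iterate_succ_apply,
      ← ih (hT.shift_mem ht), h.delay_shift hT hc ht, h.m_shift hT (hc t ht).2.2.2]

include hS hcont

/-- The axiom on the second argument covers only points beyond the first argument. `delay_eq` turns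
the question into monotonicity in the first argument of `δ₊`; using the same number of shifts for
both points makes the second arguments equal. -/
lemma strictMonoOn_delay : StrictMonoOn (δm c) S := by
  intro t ht u hu htu
  obtain ⟨k₁, hk₁⟩ := h.exists_le_shift_iterate hT hS hcont ht t₀
  obtain ⟨k₂, hk₂⟩ := h.exists_le_shift_iterate hT hS hcont hu t₀
  have ht₀ := hk₁ (max k₁ k₂) (le_max_left _ _)
  have hu₀ := hk₂ (max k₁ k₂) (le_max_right _ _)
  -- `delay_eq` with `c = t₀`, where the delay is the identity, expresses `t` and `u` through their
  -- iterates; the reverse order of iterates would reverse `t < u`.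
  have hlt : (δp T)^[max k₁ k₂] t < (δp T)^[max k₁ k₂] u := by
    obtain ⟨t1, t2⟩ := h.delay_eq hT (fun _ hr => (h.initial_m hr).1) ht _ ht₀
    obtain ⟨u1, u2⟩ := h.delay_eq hT (fun _ hr => (h.initial_m hr).1) hu _ hu₀
    rw [(h.initial_m ht).2] at t2
    rw [(h.initial_m hu).2] at u2
    by_contra! hle
    rcases hle.eq_or_lt with e | e
    · rw [e, ← t2] at u2
      exact htu.ne' u2
    · have := h.first_p _ _ _ u1 t1 e
      rw [← u2, ← t2] at this
      exact absurd htu this.not_gt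
  obtain ⟨t1, t2⟩ := h.delay_eq hT hc ht _ ht₀
  obtain ⟨u1, u2⟩ := h.delay_eq hT hc hu _ hu₀
  rw [t2, u2]
  exact h.first_p _ _ _ t1 u1 hlt

lemma surjOn_delay {v : ℝ} (hv : v ∈ S) : ∃ w ∈ S, δm c w = v := by
  have key : ∀ v ∈ S, t₀ ≤ v → ∃ w ∈ S, δm c w = v := by
    intro v hv hv₀
    obtain ⟨h1, h2⟩ := h.apply_initial v (h.subset hv) hv₀
    have h3 := h.inv_p _ _ h1
    rw [h2] at h3
    have hct := hc t₀ h.initial_mem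
    -- Since `δ₋(v, v) = t₀` and `δ₊(c, t₀)` is defined, commutation shows that `δ₊(c, v)` lies in
    -- `𝕋*`; it is the required preimage. Smaller `v` are reached by shifting forward and back.
    have h4 := h.comm_m v v c h3.1 (h3.2.symm ▸ (h.apply_initial c hct.1 hct.2.1).1)
    exact ⟨δp c v, h4.1.2.2.1, (h.inv_p c v ⟨hct.1, hct.2.1, hv, h4.1.2.2.1⟩).2⟩
  obtain ⟨k, hk⟩ := h.exists_le_shift_iterate hT hS hcont hv t₀
  replace hk := hk k le_rfl
  induction k generalizing v with
  | zero => exact key v hv hk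
  | succ k ih =>
    obtain ⟨w, hw, hwv⟩ := ih (hT.shift_mem hv) (by rwa [Function.iterate_succ_apply] at hk)
    exact ⟨δm T w, hT.shift_m_mem hw, by rw [h.delay_shift_m hT hc hw, hwv, h.m_shift hT hv]⟩

lemma continuousOn_delay : ContinuousOn (δm c) S :=
  hS.continuousOn_of_strictMonoOn (h.strictMonoOn_delay hT hS hcont hc)
    (fun t ht => (hc t ht).2.2.2) fun _ hv => h.surjOn_delay hT hS hcont hc hv

end delay

variable (h : IsShiftPair 𝕋 S t₀ δp δm) (hT : IsPeriodicInShifts 𝕋 S t₀ δp δm T)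
  (hS : IsOpenFinalSegment 𝕋 S) (hcont : ∀ t ∈ S, ContinuousWithinAt (δp T) 𝕋 t)
include h hT hS hcont

/-- The backward shift is itself a delay, with `c = T`. -/
lemma strictMonoOn_shift_m : StrictMonoOn (δm T) S :=
  h.strictMonoOn_delay hT hS hcont fun t ht => (hT.2.2 t ht).2

lemma strictMonoOn_shift : StrictMonoOn (δp T) S := by
  intro t ht u hu htu
  by_contra! hle
  have := (h.strictMonoOn_shift_m hT hS hcont).monotoneOn (hT.shift_mem hu) (hT.shift_mem ht) hle
  rw [h.m_shift hT ht, h.m_shift hT hu] at this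
  exact absurd htu this.not_gt

lemma shift_forwardJump {t : ℝ} (ht : t ∈ S) :
    δp T (forwardJump 𝕋 t) = forwardJump 𝕋 (δp T t) := by
  have hp := h.strictMonoOn_shift hT hS hcont
  have hm := h.strictMonoOn_shift_m hT hS hcont
  have hpS := fun t ht => hT.shift_mem (t := t) ht
  have hmS := fun t ht => hT.shift_m_mem (t := t) ht
  have hpm := fun t ht => h.shift_m hT (t := t) ht
  have hmp := fun t ht => h.m_shift hT (t := t) ht
  have hlt : ∀ t ∈ S, ∃ u ∈ S, t < u := fun t ht => ⟨_, hpS t ht, h.lt_shift hT ht⟩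
  refine le_antisymm (hS.apply_forwardJump_le hp hm hpS hmS hpm hmp hlt ht) ?_
  have h1 := hS.apply_forwardJump_le hm hp hmS hpS hmp hpm hlt (hpS t ht)
  rw [hmp t ht] at h1
  have h2 := hp.monotoneOn (hmS _ (hS.forwardJump_mem (hpS t ht))) (hS.forwardJump_mem ht) h1
  rwa [hpm _ (hS.forwardJump_mem (hpS t ht))] at h2

end IsShiftPair

/-! ## Linear systems that are periodic with respect to a shift -/

/-- `p` maps `S` to itself, commutes with the forward jump, and has delta derivative `p'`. -/
structure IsDeltaShift (𝕋 S : Set ℝ) (p p' : ℝ → ℝ) : Prop where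
  mem : ∀ t ∈ S, p t ∈ S
  forwardJump : ∀ t ∈ S, p (forwardJump 𝕋 t) = forwardJump 𝕋 (p t)
  hasDeltaDeriv : ∀ t ∈ S, HasDeltaDeriv 𝕋 p (p' t) t

section chain

variable {E : Type*} [NormedAddCommGroup E] [NormedSpace ℝ E] {𝕋 S : Set ℝ} {p p' : ℝ → ℝ}

/-- The chain rule takes its classical form because `p (σ t) = σ (p t)`: the increment of `p` over a
gap is exactly the graininess at `p t`. -/
lemma HasDeltaDeriv.comp_shift (hS : IsOpenFinalSegment 𝕋 S) (hp : IsDeltaShift 𝕋 S p p')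
    {f : ℝ → E} {f' : E} {t : ℝ} (ht : t ∈ S) (hf : HasDeltaDeriv 𝕋 f f' (p t)) :
    HasDeltaDeriv 𝕋 (fun r => f (p r)) (p' t • f') t := by
  have hpt := hp.hasDeltaDeriv t ht
  have hpS := hS.subset (hp.mem t ht)
  have ht𝕋 := hS.subset ht
  have hS𝕋 : S ∈ 𝓝[𝕋] t := hS.nhdsWithin_eq ht ▸ self_mem_nhdsWithin
  have hmaps : MapsTo p S 𝕋 := fun r hr => hS.subset (hp.mem r hr)
  have hσ := hp.forwardJump t ht
  rw [hasDeltaDeriv_iff ht𝕋] at hpt ⊢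
  rw [hasDeltaDeriv_iff hpS] at hf
  refine ⟨?_, ?_, fun h => ?_⟩
  · exact (hf.1.comp (hpt.1.mono hS.subset) hmaps).mono_of_mem_nhdsWithin hS𝕋
  · rw [hσ, hf.2.1, ← hσ, hpt.2.1, add_sub_cancel_left, smul_eq_mul, mul_smul]
  · have h2 : _root_.forwardJump 𝕋 (p t) = p t := by rw [← hσ, h]
    exact ((hf.2.2 h2).scomp t ((hpt.2.2 h).mono hS.subset) hmaps).mono_of_mem_nhdsWithin hS𝕋

end chain

namespace IsOpenFinalSegment

open scoped Matrix.Norms.Operator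

variable {n : ℕ} {𝕋 S : Set ℝ} {A : ℝ → Matrix (Fin n) (Fin n) ℝ} {t₀ : ℝ} {p p' : ℝ → ℝ}
  (hS : IsOpenFinalSegment 𝕋 S) (hA : RdContinuousOn 𝕋 S A) (hreg : IsRegressiveOn 𝕋 S A)
  (ht₀ : t₀ ∈ S)
include hS hA hreg ht₀

lemma transitionMatrix_inv_mul_self {t : ℝ} (ht : t ∈ S) :
    (transitionMatrix 𝕋 A t t₀)⁻¹ * transitionMatrix 𝕋 A t t₀ = 1 :=
  Matrix.nonsing_inv_mul _
    ((Matrix.isUnit_iff_isUnit_det _).1 (hS.isUnit_transitionMatrix hA hreg ht ht₀))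

lemma transitionMatrix_mul_inv_self {t : ℝ} (ht : t ∈ S) :
    transitionMatrix 𝕋 A t t₀ * (transitionMatrix 𝕋 A t t₀)⁻¹ = 1 :=
  mul_eq_one_comm.1 (hS.transitionMatrix_inv_mul_self hA hreg ht₀ ht)

lemma transitionMatrix_inv_forwardJump {t : ℝ} (ht : t ∈ S) :
    (transitionMatrix 𝕋 A (forwardJump 𝕋 t) t₀)⁻¹ =
      (transitionMatrix 𝕋 A t t₀)⁻¹ * (1 + graininess 𝕋 t • adjointCoeff 𝕋 A t) := by
  have h := (hS.hasDeltaDeriv_transitionMatrix_inv hA hreg ht₀ ht).apply_forwardJump (hS.subset ht)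
  rw [h, mul_add, mul_one, Matrix.mul_smul]

lemma transitionMatrix_inv_mul_adjointCoeff {t : ℝ} (ht : t ∈ S) :
    (transitionMatrix 𝕋 A t t₀)⁻¹ * adjointCoeff 𝕋 A t =
      -((transitionMatrix 𝕋 A (forwardJump 𝕋 t) t₀)⁻¹ * A t) := by
  rw [hS.transitionMatrix_inv_forwardJump hA hreg ht₀ ht, mul_assoc, ← mul_neg]
  exact congrArg _ (eq_neg_of_add_eq_zero_left (adjointCoeff_add_mul (hreg t ht)))

/-- Variation of constants. -/
lemma hasDeltaDeriv_transitionMatrix_inv_mulVec {t : ℝ} (ht : t ∈ S) {w : ℝ → Fin n → ℝ}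
    {g : Fin n → ℝ} (hw : HasDeltaDeriv 𝕋 w (A t *ᵥ w t + g) t) :
    HasDeltaDeriv 𝕋 (fun r => (transitionMatrix 𝕋 A r t₀)⁻¹ *ᵥ w r)
      ((transitionMatrix 𝕋 A (forwardJump 𝕋 t) t₀)⁻¹ *ᵥ g) t := by
  convert (hS.hasDeltaDeriv_transitionMatrix_inv hA hreg ht₀ ht).matrix_mulVec hw (hS.subset ht)
    using 1
  rw [hS.transitionMatrix_inv_mul_adjointCoeff hA hreg ht₀ ht, Matrix.mulVec_add,
    Matrix.neg_mulVec, Matrix.mulVec_mulVec, neg_add_cancel_left]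

lemma rdContinuousOn_transitionMatrix_inv_mulVec {h : ℝ → Fin n → ℝ} (hh : RdContinuousOn 𝕋 S h) :
    RdContinuousOn 𝕋 S fun u => (transitionMatrix 𝕋 A (forwardJump 𝕋 u) t₀)⁻¹ *ᵥ h u :=
  (rdContinuousOn_comp_forwardJump hS.isClosed hS.subset
    (f := fun u => (transitionMatrix 𝕋 A u t₀)⁻¹) fun _ ht =>
      (hS.hasDeltaDeriv_transitionMatrix_inv hA hreg ht₀ ht).continuousWithinAt (hS.subset ht)).map₂
    hh (φ := fun M v => M *ᵥ v) (Continuous.matrix_mulVec continuous_fst continuous_snd)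

variable (hp : IsDeltaShift 𝕋 S p p') (hpA : ∀ t ∈ S, p' t • A (p t) = A t)
include hp hpA

/-- The monodromy relation. -/
lemma transitionMatrix_shift {t : ℝ} (ht : t ∈ S) : transitionMatrix 𝕋 A (p t) t₀ =
    transitionMatrix 𝕋 A t t₀ * transitionMatrix 𝕋 A (p t₀) t₀ := by
  -- By the chain rule and `p' • A(p r) = A(r)`, `Φ(p r)` solves the same system, so its product
  -- with `Φ(r)⁻¹` is constant; the constant is read off at `t₀`.
  have h := hS.eq_of_hasDeltaDeriv_zero
    (f := fun r => (transitionMatrix 𝕋 A r t₀)⁻¹ * transitionMatrix 𝕋 A (p r) t₀)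
    (fun r hr => ?_) ht ht₀
  · simp only [hS.transitionMatrix_self hA hreg ht₀, inv_one, one_mul] at h
    rw [← h, ← mul_assoc, hS.transitionMatrix_mul_inv_self hA hreg ht₀ ht, one_mul]
  · have h1 := (hS.hasDeltaDeriv_transitionMatrix hA hreg ht₀ (hp.mem r hr)).comp_shift hS hp hr
    convert (hS.hasDeltaDeriv_transitionMatrix_inv hA hreg ht₀ hr).matrix_mul h1 (hS.subset hr)
      using 1
    rw [hS.transitionMatrix_inv_mul_adjointCoeff hA hreg ht₀ hr, ← Matrix.smul_mul, hpA r hr,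
      ← mul_assoc, neg_mul, neg_add_cancel]

lemma transitionMatrix_inv_shift {t : ℝ} (ht : t ∈ S) : (transitionMatrix 𝕋 A (p t) t₀)⁻¹ =
    (transitionMatrix 𝕋 A (p t₀) t₀)⁻¹ * (transitionMatrix 𝕋 A t t₀)⁻¹ := by
  rw [hS.transitionMatrix_shift hA hreg ht₀ hp hpA ht, Matrix.mul_inv_rev]

/-- The solutions of a linear inhomogeneous system that are periodic with respect to a shift. -/
theorem periodic_solution_iff {h w : ℝ → Fin n → ℝ} (hh : RdContinuousOn 𝕋 S h)
    (hph : ∀ t ∈ S, p' t • h (p t) = h t) (hpw : ∀ t ∈ S, w (p t) = w t)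
    (hM : IsUnit ((transitionMatrix 𝕋 A (p t₀) t₀)⁻¹ - 1)) :
    (∀ t ∈ S, HasDeltaDeriv 𝕋 w (A t *ᵥ w t + h t) t) ↔
      ∀ t ∈ S, w t = (transitionMatrix 𝕋 A t t₀ * ((transitionMatrix 𝕋 A (p t₀) t₀)⁻¹ - 1)⁻¹) *ᵥ
        deltaIntegral 𝕋 (fun u => (transitionMatrix 𝕋 A (forwardJump 𝕋 u) t₀)⁻¹ *ᵥ h u) t (p t) := by
  set M := (transitionMatrix 𝕋 A (p t₀) t₀)⁻¹ - 1 with hMdef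
  have hMM : M⁻¹ * M = 1 := Matrix.nonsing_inv_mul _ ((Matrix.isUnit_iff_isUnit_det _).1 hM)
  set k : ℝ → Fin n → ℝ := fun u => (transitionMatrix 𝕋 A (forwardJump 𝕋 u) t₀)⁻¹ *ᵥ h u with hk
  have hkrd : RdContinuousOn 𝕋 S k :=
    hS.rdContinuousOn_transitionMatrix_inv_mulVec hA hreg ht₀ hh
  have hK : ∀ t ∈ S, HasDeltaDeriv 𝕋 (deltaIntegral 𝕋 k t₀) (k t) t := fun t ht =>
    hS.hasDeltaDeriv_deltaIntegral hkrd ht₀ ht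
  have hint : ∀ t ∈ S, deltaIntegral 𝕋 k t (p t) =
      deltaIntegral 𝕋 k t₀ (p t) - deltaIntegral 𝕋 k t₀ t := fun t ht =>
    (hS.deltaIntegral_sub hkrd ht₀ ht (hp.mem t ht)).symm
  constructor
  · intro hw t ht
    have hv : ∀ r ∈ S, HasDeltaDeriv 𝕋 (fun r => (transitionMatrix 𝕋 A r t₀)⁻¹ *ᵥ w r) (k r) r :=
      fun r hr => hS.hasDeltaDeriv_transitionMatrix_inv_mulVec hA hreg ht₀ hr (hw r hr)
    -- `Φ⁻¹ w` and the primitive of `k` have the same derivative. Comparing `t` with `p t`, where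
    -- `w` takes equal values, leaves `M Φ⁻¹(t) w(t)` as the integral.
    have hconst := hS.eq_of_hasDeltaDeriv_zero (f := fun r =>
      (transitionMatrix 𝕋 A r t₀)⁻¹ *ᵥ w r - deltaIntegral 𝕋 k t₀ r) (fun r hr => by
        simpa using (hv r hr).sub (hK r hr) (hS.subset hr)) (hp.mem t ht) ht
    have h1 : deltaIntegral 𝕋 k t (p t) = M *ᵥ ((transitionMatrix 𝕋 A t t₀)⁻¹ *ᵥ w t) := by
      rw [hint t ht, hMdef, Matrix.sub_mulVec, Matrix.one_mulVec, Matrix.mulVec_mulVec,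
        ← hS.transitionMatrix_inv_shift hA hreg ht₀ hp hpA ht]
      have h2 : (transitionMatrix 𝕋 A (p t) t₀)⁻¹ *ᵥ w t - deltaIntegral 𝕋 k t₀ (p t) =
          (transitionMatrix 𝕋 A t t₀)⁻¹ *ᵥ w t - deltaIntegral 𝕋 k t₀ t := by
        simpa only [hpw t ht] using hconst
      rw [sub_eq_sub_iff_add_eq_add] at h2 ⊢
      rw [add_comm, ← h2, add_comm]
    rw [h1, ← Matrix.mulVec_mulVec, Matrix.mulVec_mulVec _ M⁻¹, hMM, Matrix.one_mulVec,
      Matrix.mulVec_mulVec, hS.transitionMatrix_mul_inv_self hA hreg ht₀ ht, Matrix.one_mulVec]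
  · intro hw t ht
    have ht𝕋 := hS.subset ht
    have hσS := hS.forwardJump_mem ht
    have hJ : HasDeltaDeriv 𝕋 (fun r => M⁻¹ *ᵥ (deltaIntegral 𝕋 k t₀ (p r) -
        deltaIntegral 𝕋 k t₀ r)) (k t) t := by
      have h1 := ((hK (p t) (hp.mem t ht)).comp_shift hS hp ht).sub (hK t ht) ht𝕋
      have h2 := (hasDeltaDeriv_const M⁻¹ ht𝕋).matrix_mulVec h1 ht𝕋
      convert h2 using 1
      -- `k` is not periodic: the shift multiplies it by the inverse monodromy matrix. Hence the
      -- derivative of `∫_t^{p t} k` is `M k(t)`, and `M⁻¹` restores `k(t)`.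
      have h3 : p' t • k (p t) = (transitionMatrix 𝕋 A (p t₀) t₀)⁻¹ *ᵥ k t := by
        simp only [hk]
        rw [← hp.forwardJump t ht, hS.transitionMatrix_inv_shift hA hreg ht₀ hp hpA hσS,
          ← Matrix.mulVec_mulVec, ← Matrix.mulVec_smul, ← Matrix.mulVec_smul, hph t ht]
      have h4 : p' t • k (p t) - k t = M *ᵥ k t := by
        rw [h3, hMdef, Matrix.sub_mulVec, Matrix.one_mulVec]
      rw [h4, Matrix.zero_mulVec, zero_add, Matrix.mulVec_mulVec, hMM, Matrix.one_mulVec]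
    have h5 := (hS.hasDeltaDeriv_transitionMatrix hA hreg ht₀ ht).matrix_mulVec hJ ht𝕋
    have hval : ∀ r ∈ S, w r = transitionMatrix 𝕋 A r t₀ *ᵥ (M⁻¹ *ᵥ (deltaIntegral 𝕋 k t₀ (p r) -
        deltaIntegral 𝕋 k t₀ r)) := fun r hr => by
      rw [hw r hr, hint r hr, Matrix.mulVec_mulVec]
    have h6 := h5.congr_of_eventuallyEq (g := w) ht𝕋 ?_ (hval _ hσS)
    · convert h6 using 1
      rw [← Matrix.mulVec_mulVec, ← hval t ht]
      simp only [hk]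
      rw [Matrix.mulVec_mulVec, hS.transitionMatrix_mul_inv_self hA hreg ht₀ hσS, Matrix.one_mulVec]
    · rw [← hS.nhdsWithin_eq ht]
      exact eventually_nhdsWithin_of_forall hval

end IsOpenFinalSegment

lemma hasDeltaDeriv_deltaDeriv {E : Type*} [NormedAddCommGroup E] [NormedSpace ℝ E] {𝕋 S : Set ℝ}
    {f : ℝ → E} (hf : DeltaDifferentiableOn 𝕋 S f) {t : ℝ} (ht : t ∈ S) :
    HasDeltaDeriv 𝕋 f (deltaDeriv 𝕋 f t) t :=
  Classical.epsilon_spec (hf t ht)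

open scoped Matrix.Norms.Operator in
/-- For a non-critical periodic system, `Φ⁻¹(δ₊^T(t₀), t₀) - I` is invertible. -/
lemma IsNoncritical.isUnit {n : ℕ} {𝕋 S : Set ℝ} {t₀ : ℝ} {δp δm : ℝ → ℝ → ℝ} {T : ℝ}
    {A : ℝ → Matrix (Fin n) (Fin n) ℝ} (hnc : IsNoncritical 𝕋 S δp δm T A)
    (hshift : IsShiftPair 𝕋 S t₀ δp δm) (hT : IsPeriodicInShifts 𝕋 S t₀ δp δm T)
    (hS : IsOpenFinalSegment 𝕋 S) (hA : RdContinuousOn 𝕋 S A) (hreg : IsRegressiveOn 𝕋 S A)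
    (hp : IsDeltaShift 𝕋 S (δp T) (deltaDeriv 𝕋 (δp T)))
    (hpA : ∀ t ∈ S, deltaDeriv 𝕋 (δp T) t • A (δp T t) = A t) :
    IsUnit ((transitionMatrix 𝕋 A (δp T t₀) t₀)⁻¹ - 1) := by
  have ht₀ := hshift.initial_mem
  rw [Matrix.isUnit_iff_isUnit_det, isUnit_iff_ne_zero]
  intro hdet
  obtain ⟨v, hv0, hv⟩ := Matrix.exists_mulVec_eq_zero_iff.2 hdet
  -- A kernel vector is fixed by the monodromy matrix, so `Φ(t) v` is shift-periodic; it equals `v ≠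
  -- 0` at `t₀`.
  have hfix : transitionMatrix 𝕋 A (δp T t₀) t₀ *ᵥ v = v := by
    rw [Matrix.sub_mulVec, Matrix.one_mulVec, sub_eq_zero] at hv
    nth_rewrite 1 [← hv]
    rw [Matrix.mulVec_mulVec, hS.transitionMatrix_mul_inv_self hA hreg ht₀ (hp.mem _ ht₀),
      Matrix.one_mulVec]
  have hz : ∀ t ∈ S, HasDeltaDeriv 𝕋 (fun r => transitionMatrix 𝕋 A r t₀ *ᵥ v)
      (A t *ᵥ (transitionMatrix 𝕋 A t t₀ *ᵥ v)) t := fun t ht => by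
    have := (hS.hasDeltaDeriv_transitionMatrix hA hreg ht₀ ht).matrix_mulVec
      (hasDeltaDeriv_const v (hS.subset ht)) (hS.subset ht)
    rwa [Matrix.mulVec_zero, add_zero, ← Matrix.mulVec_mulVec] at this
  have hper : ∀ t ∈ S, transitionMatrix 𝕋 A (δp T t) t₀ *ᵥ v = transitionMatrix 𝕋 A t t₀ *ᵥ v :=
    fun t ht => by
      rw [hS.transitionMatrix_shift hA hreg ht₀ hp hpA ht, ← Matrix.mulVec_mulVec, hfix]
  refine hnc ⟨fun r => transitionMatrix 𝕋 A r t₀ *ᵥ v, ⟨fun t ht => ?_, fun t ht => ⟨hper t ht, ?_⟩⟩,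
    hz, t₀, ht₀, ?_⟩
  · exact ((hz t ht).continuousWithinAt (hS.subset ht)).mono hS.subset
  · have := hper _ (hT.shift_m_mem ht)
    rw [hshift.shift_m hT ht] at this
    exact this.symm
  · change transitionMatrix 𝕋 A t₀ t₀ *ᵥ v ≠ 0
    rwa [hS.transitionMatrix_self hA hreg ht₀, Matrix.one_mulVec]

lemma isSolution_iff_isNeutralSolution {n : ℕ} {𝕋 S : Set ℝ} (hS𝕋 : S ⊆ 𝕋) {δm : ℝ → ℝ → ℝ}
    {s : ℝ} {A : ℝ → Matrix (Fin n) (Fin n) ℝ} {Q : ℝ → (Fin n → ℝ) → (Fin n → ℝ)}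
    {G : ℝ → (Fin n → ℝ) → (Fin n → ℝ) → (Fin n → ℝ)} {x : ℝ → Fin n → ℝ}
    (hQ : DeltaDifferentiableOn 𝕋 S fun t => Q t (x (δm s t))) :
    IsSolution 𝕋 S δm s A Q G x ↔ IsNeutralSolution 𝕋 S δm s A Q G x := by
  refine ⟨fun h t ht => ?_, fun h => ⟨hQ, fun t ht => ?_⟩⟩
  · convert (h.2 t ht).sub (hasDeltaDeriv_deltaDeriv hQ ht) (hS𝕋 ht) using 1
    abel
  · have := (h t ht).add (hasDeltaDeriv_deltaDeriv hQ ht) (hS𝕋 ht)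
    convert this using 1
    · funext r; simp
    · abel

end

/-! ### The equivalence for the neutral system. -/

theorem mainTheorem4 {n : ℕ} (𝕋 Tstar : Set ℝ) (t₀ : ℝ) (δp δm : ℝ → ℝ → ℝ) (T s : ℝ)
    (A : ℝ → Matrix (Fin n) (Fin n) ℝ) (Q : ℝ → (Fin n → ℝ) → (Fin n → ℝ))
    (G : ℝ → (Fin n → ℝ) → (Fin n → ℝ) → (Fin n → ℝ))
    -- the time scale, its shift operators, and the delay
    (h𝕋 : IsClosed 𝕋)
    (hshift : IsShiftPair 𝕋 Tstar t₀ δp δm)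
    (hconv : ∀ t ∈ Tstar, Set.uIcc t₀ t ∩ 𝕋 ⊆ Tstar)
    (hT : IsPeriodicInShifts 𝕋 Tstar t₀ δp δm T)
    (hsmooth : SmoothShifts 𝕋 Tstar δp δm T)
    (hs : ∀ t ∈ Tstar, (s, t) ∈ shiftDomain 𝕋 Tstar t₀ δm)
    -- regularity of the coefficients
    (hA : RdContinuousOn 𝕋 Tstar A)
    (hAreg : IsRegressiveOn 𝕋 Tstar A)
    (hQ : ∀ y : ℝ → Fin n → ℝ, ContinuousOn y Tstar → RdContinuousOn 𝕋 Tstar (fun t => Q t (y t)))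
    (hG : ∀ y z : ℝ → Fin n → ℝ, ContinuousOn y Tstar → ContinuousOn z Tstar →
      RdContinuousOn 𝕋 Tstar (fun t => G t (y t) (z t)))
    -- periodicity of the coefficients
    (hAper : DeltaPeriodic 𝕋 Tstar δp δm T A)
    (hQper : ∀ y ∈ periodicSpace n Tstar δp δm T, ∀ t ∈ Tstar,
      Q (δp T t) (y (δm s (δp T t))) = Q t (y (δm s t)) ∧
      Q (δm T t) (y (δm s (δm T t))) = Q t (y (δm s t)))
    (hGper : ∀ y ∈ periodicSpace n Tstar δp δm T,
      DeltaPeriodic 𝕋 Tstar δp δm T (fun t => G t (y t) (y (δm s t))))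
    (hne : ∃ t ∈ Tstar, ∃ q : Fin n → ℝ, HasDeltaDeriv 𝕋 (fun r => Q r 0) q t ∧ q + G t 0 0 ≠ 0)
    -- the homogeneous system is non-critical
    (hnc : IsNoncritical 𝕋 Tstar δp δm T A)
    (x : ℝ → Fin n → ℝ) (hx : x ∈ periodicSpace n Tstar δp δm T) (x₀ : Fin n → ℝ) :
    -- the inverse matrices in the integral equation exist
    (∀ t ∈ Tstar, IsUnit (transitionMatrix 𝕋 A t t₀)) ∧
    IsUnit ((transitionMatrix 𝕋 A (δp T t₀) t₀)⁻¹ - 1) ∧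
    -- the equivalence
    (DeltaDifferentiableOn 𝕋 Tstar (fun t => Q t (x (δm s t))) →
      ((IsSolution 𝕋 Tstar δm s A Q G x ∧ x t₀ = x₀) ↔
        (SatisfiesIntegralEquation 𝕋 Tstar t₀ δp δm T s A Q G x ∧ x t₀ = x₀))) ∧
    -- the equivalence when only the neutral difference has to be differentiable
    ((IsNeutralSolution 𝕋 Tstar δm s A Q G x ∧ x t₀ = x₀) ↔
      (SatisfiesIntegralEquation 𝕋 Tstar t₀ δp δm T s A Q G x ∧ x t₀ = x₀)) := by
  have hS : IsOpenFinalSegment 𝕋 Tstar := hshift.isOpenFinalSegment hT h𝕋 hconv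
  have ht₀ := hshift.initial_mem
  have hp' : ∀ t ∈ Tstar, HasDeltaDeriv 𝕋 (δp T) (deltaDeriv 𝕋 (δp T) t) t := fun t ht =>
    hasDeltaDeriv_deltaDeriv hsmooth.1 ht
  have hcont : ∀ t ∈ Tstar, ContinuousWithinAt (δp T) 𝕋 t := fun t ht =>
    (hp' t ht).continuousWithinAt (hS.subset ht)
  have hp : IsDeltaShift 𝕋 Tstar (δp T) (deltaDeriv 𝕋 (δp T)) :=
    ⟨fun t ht => hT.shift_mem ht, fun t ht => hshift.shift_forwardJump hT hS hcont ht, hp'⟩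
  have hpA : ∀ t ∈ Tstar, deltaDeriv 𝕋 (δp T) t • A (δp T t) = A t := fun t ht => (hAper t ht).1
  have hM := hnc.isUnit hshift hT hS hA hAreg hp hpA
  -- `hQ` and `hG` accept only continuous arguments, so the delayed function must be shown
  -- continuous.
  have hxd : ContinuousOn (fun t => x (δm s t)) Tstar :=
    hx.1.comp (hshift.continuousOn_delay hT hS hcont hs) fun t ht => (hs t ht).2.2.2
  have hqrd : RdContinuousOn 𝕋 Tstar fun t => Q t (x (δm s t)) := hQ _ hxd
  have hgrd : RdContinuousOn 𝕋 Tstar fun t => G t (x t) (x (δm s t)) := hG _ _ hx.1 hxd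
  have hhrd : RdContinuousOn 𝕋 Tstar fun t =>
      A t *ᵥ Q t (x (δm s t)) + G t (x t) (x (δm s t)) :=
    (hA.map₂ hqrd (φ := fun M v => M *ᵥ v)
      (Continuous.matrix_mulVec continuous_fst continuous_snd)).map₂ hgrd
      (φ := fun v w => v + w) continuous_add
  have hneutral : IsNeutralSolution 𝕋 Tstar δm s A Q G x ↔
      SatisfiesIntegralEquation 𝕋 Tstar t₀ δp δm T s A Q G x := by
    have key := hS.periodic_solution_iff hA hAreg ht₀ hp hpA
      (w := fun t => x t - Q t (x (δm s t))) hhrd (fun t ht => ?_) (fun t ht => ?_) hM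
    · refine Iff.trans (forall₂_congr fun t ht => ?_) (key.trans (forall₂_congr fun t ht => ?_))
      -- `A x + G = A (x - Q) + (A Q + G)`.
      · rw [Matrix.mulVec_sub, ← add_assoc, sub_add_cancel]
      · rw [sub_eq_iff_eq_add']
    · have hg := (hGper x hx t ht).1
      rw [smul_add, ← Matrix.smul_mulVec, hpA t ht, hg, (hQper x hx t ht).1]
    · rw [(hx.2 t ht).1, (hQper x hx t ht).1]
  refine ⟨fun t ht => hS.isUnit_transitionMatrix hA hAreg ht ht₀, hM, fun hQd => ?_, ?_⟩
  · rw [isSolution_iff_isNeutralSolution hS.subset hQd, hneutral]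
  · rw [hneutral]
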